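/- Let $n\in\mathbb N$, $T>0$, $\omega=2\pi/T$. For a real $n\times n$ matrix function $F\in L^2_{loc}(\mathbb R)$ put $F_k(t)=\frac1T\int_{t-T}^tF(\tau)e^{-j\omega k\tau}\,d\tau$ ($k\in\mathbb Z$), and let $\mathcal T_T(F)(t)$ be the infinite block Toeplitz matrix whose $(k,l)$ block is $F_{k-l}(t)$, $k,l\in\mathbb Z$; it is constant in $t$ if $F$ is $T$-periodic. Let $\mathcal N=\mathrm{diag}(j\omega k\,\mathrm{Id}_n,\ k\in\mathbb Z)$. An infinite matrix $M$ acts on $\ell^2=\ell^2(\mathbb Z;\mathbb C^n)$ with its maximal domain: the $X\in\ell^2$ for which the series defining $MX$ converge and $MX\in\ell^2$. It is called positive definite if $\operatorname{Re}\,X^*MX>0$ for every nonzero $X$ in this domain. Let $A$ be a $T$-periodic real $n\times n$ matrix function with $A\in L^2([0,T])$, and let $Q$ be a $T$-periodic real $n\times n$ matrix function with $Q\in L^\infty([0,T])$ and $Q(t)$ symmetric positive definite for almost every $t$. Put $\mathcal A=\mathcal T_T(A)$ and $\mathcal Q=\mathcal T_T(Q)$. Then $\mathcal Q$ is Hermitian,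 positive definite and bounded on $\ell^2$. Moreover, for every real $n\times n$ matrix function $P\in L^2_{loc}(\mathbb R)$, functions being identified when they agree almost everywhere, the following are equivalent: 1. $P$ is the unique $T$-periodic, symmetric positive definite, locally absolutely continuous solution (the equation holding for almost every $t$) of $$\dot P(t)+A'(t)P(t)+P(t)A(t)+Q(t)=0 .$$ 2. For every $t$, $\mathcal P=\mathcal T_T(P)(t)$ is the unique Hermitian positive definite solution of $$\mathcal P(\mathcal A-\mathcal N)+(\mathcal A-\mathcal N)^*\mathcal P+\mathcal Q=0 ,$$ where a solution is an infinite block matrix (not assumed to be block Toeplitz or bounded) whose domain contains the domain of $\mathcal N$ and for which the series defining the two matrix products converge and the equation holds entry by entry. If these conditions hold, $\mathcal P=\mathcal T_T(P)$ is a bounded operator on $\ell^2$. -/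

import Mathlib

open MeasureTheory

namespace Harmonic

/-- Infinite block matrices with blocks of size `n × n`, the blocks being indexed by `ℤ × ℤ`. -/
abbrev BlockMatrix (n : ℕ) : Type := Matrix (ℤ × Fin n) (ℤ × Fin n) ℂ

/-- The Hilbert space `ℓ²(ℤ; ℂⁿ)`; the `k`-th block of `X` is `a ↦ X (k, a)`. -/
abbrev EllTwo (n : ℕ) : Type := lp (fun _ : ℤ × Fin n => ℂ) 2

/-- The `k`-th phasor at time `t` (sliding window of length `T`) of a matrix function:
`F_k(t) = (1/T) ∫_{t-T}^t F(τ) exp(-j ω k τ) dτ`, with `ω = 2π/T`. -/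
noncomputable def phasor {n : ℕ} (T : ℝ) (F : ℝ → Matrix (Fin n) (Fin n) ℝ) (k : ℤ) (t : ℝ) :
    Matrix (Fin n) (Fin n) ℂ :=
  fun a b => (1 / (T : ℂ)) * ∫ τ in (t - T)..t,
    (F τ a b : ℂ) * Complex.exp (-(Complex.I * (2 * Real.pi / T : ℝ) * k * τ))

/-- The block Toeplitz matrix of `F` at time `t`: its `(k, l)` block is `F_{k-l}(t)`. -/
noncomputable def toeplitz {n : ℕ} (T : ℝ) (F : ℝ → Matrix (Fin n) (Fin n) ℝ) (t : ℝ) :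
    BlockMatrix n :=
  fun p q => phasor T F (p.1 - q.1) t p.2 q.2

/-- `N = diag(j ω k Id_n, k ∈ ℤ)`, with `ω = 2π/T`. -/
noncomputable def diagN (n : ℕ) (T : ℝ) : BlockMatrix n :=
  Matrix.diagonal fun p => Complex.I * (2 * Real.pi / T : ℝ) * p.1

/-- The series defining the matrix product `M * M'` converge, entry by entry. -/
def MulConverges {n : ℕ} (M M' : BlockMatrix n) : Prop :=
  ∀ p q, Summable fun r => M p r * M' r q

/-- The product of two infinite matrices (meaningful when `MulConverges M M'`). -/
noncomputable def infMul {n : ℕ} (M M' : BlockMatrix n) : BlockMatrix n :=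
  fun p q => ∑' r, M p r * M' r q

/-- `X ∈ ℓ²` lies in the (maximal) domain of the operator defined by the matrix `M`, and
`M X = Y ∈ ℓ²`. -/
def ActsTo {n : ℕ} (M : BlockMatrix n) (X Y : EllTwo n) : Prop :=
  ∀ p, HasSum (fun q => M p q * X q) (Y p)

/-- The matrix `M` defines a bounded operator on `ℓ²`. -/
def IsBoundedOnEllTwo {n : ℕ} (M : BlockMatrix n) : Prop :=
  ∃ B : EllTwo n →L[ℂ] EllTwo n, ∀ X, ActsTo M X (B X)

/-- `X^* M X > 0` for every nonzero `X` in the domain of the operator defined by `M`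
(for a bounded operator: for every nonzero `X ∈ ℓ²`). -/
def IsPositiveDefinite {n : ℕ} (M : BlockMatrix n) : Prop :=
  ∀ X Y : EllTwo n, ActsTo M X Y → X ≠ 0 → 0 < (inner ℂ X Y).re

/-- `calP` is a Hermitian positive definite solution of
`calP (calA - N) + (calA - N)^* calP + calQ = 0`. The matrix `calP` is neither assumed to be block Toeplitz nor to
be bounded: it is only required to define an operator with values in `ℓ²` on the domain of `N`. -/
structure IsHarmonicLyapunovSolution {n : ℕ} (T : ℝ) (calA calQ calP : BlockMatrix n) : Prop where
  hermitian : calP.IsHermitian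
  domain : ∀ X Y : EllTwo n, ActsTo (diagN n T) X Y → ∃ Z, ActsTo calP X Z
  posDef : IsPositiveDefinite calP
  converges_left : MulConverges calP (calA - diagN n T)
  converges_right : MulConverges (calA - diagN n T).conjTranspose calP
  equation : infMul calP (calA - diagN n T) + infMul (calA - diagN n T).conjTranspose calP + calQ = 0

/-- `calP` is the unique Hermitian positive definite solution of the harmonic Lyapunov equation. -/
def IsUniqueHarmonicSolution {n : ℕ} (T : ℝ) (calA calQ calP : BlockMatrix n) : Prop :=
  IsHarmonicLyapunovSolution T calA calQ calP ∧
    ∀ calP' : BlockMatrix n, IsHarmonicLyapunovSolution T calA calQ calP' → calP' = calP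

/-- `P` is a `T`-periodic, symmetric positive definite Carathéodory solution of
`Ṗ + A' P + P A + Q = 0`. For real matrices `Matrix.PosDef` includes symmetry. -/
structure IsPeriodicLyapunovSolution {n : ℕ} (T : ℝ) (A Q P : ℝ → Matrix (Fin n) (Fin n) ℝ) :
    Prop where
  periodic : Function.Periodic P T
  posDef : ∀ t, (P t).PosDef
  absCont : ∀ i j a b, AbsolutelyContinuousOnInterval (fun t => P t i j) a b
  equation : ∀ᵐ t : ℝ, ∀ i j, HasDerivAt (fun s => P s i j)
    (-(((A t).transpose * P t + P t * A t + Q t) i j)) t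

/-- `P` is the unique `T`-periodic symmetric positive definite solution of the periodic Lyapunov
differential equation. -/
def IsUniquePeriodicSolution {n : ℕ} (T : ℝ) (A Q P : ℝ → Matrix (Fin n) (Fin n) ℝ) : Prop :=
  IsPeriodicLyapunovSolution T A Q P ∧
    ∀ P' : ℝ → Matrix (Fin n) (Fin n) ℝ, IsPeriodicLyapunovSolution T A Q P' → P' = P

end Harmonic

/-! Fourier series identify `ℓ²(ℤ; ℂⁿ)` with square integrable functions on one period. Block
Toeplitz matrices become multiplication by their symbol, `N` becomes differentiation of periodic
functions, and for a bounded symbol `F` the form `X^* M X` is the mean of `x^* F x`. For a Toeplitz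
unknown, entry `(k, l)` of the harmonic equation depends only on `k - l` and says that this Fourier
coefficient of `Ṗ + A' P + P A + Q` vanishes (`lyapunov_entry`). A periodic solution thus gives a
harmonic one, bounded because `P` is continuous.

The hard point is uniqueness among matrices that need be neither Toeplitz nor bounded
(`eq_zero_of_homogeneous`). The difference `D` of two solutions is Hermitian and satisfies `D L +
L^* D = 0` entrywise, with `L = A - N`. Composed with `(1 + N)⁻¹`, both `D` and `L` are bounded by
the closed graph theorem, so the entrywise identity extends to a form identity on the domain of `N`.
Floquet theory supplies test vectors there: write the monodromy matrix as `Φ(T) = exp (T R)` and put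
`Z = Φ exp (-t R)`. The columns of `Z` and of its modulations by `exp (-jωkt)` span
finite-dimensional `L`-invariant spaces, on which `L` acts by `R + jωk`. The matrix `B` of the form
of `D` between two such families solves a homogeneous Sylvester equation; integrating it over a
period gives `Φ(T)^* B Φ(T) = B`. The form of `P` strictly decreases along the flow, so the powers
of `Φ(T)` tend to zero and `B = 0`. As `Z(t)` is invertible, the modulated columns are total, and `D
= 0`.

Conversely, `A` and `Q` being periodic, the harmonic equation is the same at all times, so
uniqueness makes the Toeplitz matrix of `P` constant in time. Comparing windows one period apart
shows that `P` is periodic almost everywhere (`exists_periodic_ae_eq`). The entries of the equation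
then prescribe the Fourier coefficients of a derivative, so `P` agrees almost everywhere with a
primitive (`exists_absolutelyContinuous_solution`). Testing on indicator functions gives a
nonnegative form, and strict decrease along the flow makes it definite. -/

namespace Harmonic

open Set ComplexConjugate Matrix Filter NormedSpace
open scoped ComplexOrder

variable {n : ℕ}

/-! ### Fourier coefficients on a period: Parseval, Riesz–Fischer, convolution. -/

/-- The `k`-th Fourier coefficient of `f` over the period `[0, T]`. -/
noncomputable def fc (T : ℝ) (f : ℝ → ℂ) (k : ℤ) : ℂ :=
  (1 / (T : ℂ)) * ∫ τ in (0 : ℝ)..T,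
    f τ * Complex.exp (-(Complex.I * (2 * Real.pi / T : ℝ) * k * τ))

/-- Square integrability over the period `(0, T]`. -/
abbrev SqInt (T : ℝ) (f : ℝ → ℂ) : Prop := MemLp f 2 (volume.restrict (Ioc 0 T))

lemma fourier_neg_eq_exp (T : ℝ) (k : ℤ) (t : ℝ) :
    fourier (-k) (t : AddCircle T) =
      Complex.exp (-(Complex.I * (2 * Real.pi / T : ℝ) * k * t)) := by
  rw [fourier_coe_apply]
  congr 1
  push_cast
  ring

lemma fc_eq_fourierCoeff {T : ℝ} [hT : Fact (0 < T)] (g : AddCircle T → ℂ) (k : ℤ) :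
    fourierCoeff g k = fc T (fun t => g t) k := by
  rw [fourierCoeff_eq_intervalIntegral g k 0, fc, zero_add, Complex.real_smul]
  push_cast
  congr 1
  refine intervalIntegral.integral_congr fun t _ => ?_
  simp only [smul_eq_mul]
  rw [fourier_neg_eq_exp, mul_comm]
  push_cast
  rfl

lemma fc_congr_ae {T : ℝ} (hT : 0 < T) {f g : ℝ → ℂ}
    (h : f =ᵐ[volume.restrict (Ioc 0 T)] g) (k : ℤ) : fc T f k = fc T g k := by
  unfold fc
  congr 1
  refine intervalIntegral.integral_congr_ae ?_
  rw [uIoc_of_le hT.le]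
  rw [Filter.EventuallyEq, ae_restrict_iff' measurableSet_Ioc] at h
  filter_upwards [h] with t ht hm
  rw [ht hm]

lemma liftIoc_ae {T : ℝ} [hT : Fact (0 < T)] (f : ℝ → ℂ) :
    (fun t : ℝ => AddCircle.liftIoc T 0 f t) =ᵐ[volume.restrict (Ioc 0 T)] f := by
  rw [Filter.EventuallyEq, ae_restrict_iff' measurableSet_Ioc]
  exact .of_forall fun t ht => AddCircle.liftIoc_zero_coe_apply ht

lemma fourierCoeff_liftIoc {T : ℝ} [hT : Fact (0 < T)] (f : ℝ → ℂ) (k : ℤ) :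
    fourierCoeff (AddCircle.liftIoc T 0 f) k = fc T f k := by
  rw [fc_eq_fourierCoeff]
  exact fc_congr_ae hT.out (liftIoc_ae f) k

lemma memLp_lift {T : ℝ} [hT : Fact (0 < T)] {f : ℝ → ℂ} (hf : SqInt T f) :
    MemLp (AddCircle.liftIoc T 0 f) 2 (@AddCircle.haarAddCircle T hT) :=
  (MemLp.memLp_liftIoc (t := 0) (by simpa using hf)).haarAddCircle

lemma repr_toLp_lift {T : ℝ} [hT : Fact (0 < T)] {f : ℝ → ℂ} (hf : SqInt T f) (k : ℤ) :
    fourierBasis.repr (memLp_lift hf).toLp k = fc T f k := by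
  rw [fourierBasis_repr, fourierCoeff_congr_ae (memLp_lift hf).coeFn_toLp, fourierCoeff_liftIoc]

lemma memlp_fc {T : ℝ} (hT : 0 < T) {f : ℝ → ℂ} (hf : SqInt T f) : Memℓp (fc T f) 2 := by
  have : Fact (0 < T) := ⟨hT⟩
  have := (fourierBasis.repr (memLp_lift hf).toLp).2
  have h : fc T f = fourierBasis.repr (memLp_lift hf).toLp :=
    funext fun k => (repr_toLp_lift hf k).symm
  rw [h]
  exact this

/-- Parseval's identity in polarised form. -/
lemma hasSum_conj_fc_mul_fc {T : ℝ} (hT : 0 < T) {f g : ℝ → ℂ} (hf : SqInt T f)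
    (hg : SqInt T g) :
    HasSum (fun k => conj (fc T f k) * fc T g k)
      ((1 / (T : ℂ)) * ∫ τ in (0 : ℝ)..T, conj (f τ) * g τ) := by
  have : Fact (0 < T) := ⟨hT⟩
  have h := lp.hasSum_inner (𝕜 := ℂ) (fourierBasis.repr (memLp_lift hf).toLp)
    (fourierBasis.repr (memLp_lift hg).toLp)
  simp only [LinearIsometryEquiv.inner_map_map, repr_toLp_lift hf, repr_toLp_lift hg,
    RCLike.inner_apply'] at h
  convert! h using 1
  rw [MeasureTheory.L2.inner_def]
  have : ∫ a, inner ℂ ((memLp_lift hf).toLp _ a) ((memLp_lift hg).toLp _ a)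
      ∂(@AddCircle.haarAddCircle T _) =
      ∫ a, AddCircle.liftIoc T 0 (fun t => conj (f t) * g t) a
        ∂(@AddCircle.haarAddCircle T _) := by
    refine integral_congr_ae ?_
    filter_upwards [(memLp_lift hf).coeFn_toLp, (memLp_lift hg).coeFn_toLp] with a h1 h2
    rw [h1, h2, RCLike.inner_apply']
    rfl
  rw [this, AddCircle.integral_haarAddCircle, AddCircle.integral_liftIoc_eq_intervalIntegral,
    zero_add, Complex.real_smul]
  simp

/-- Riesz–Fischer: the Fourier isometry is onto, and its preimage is pulled back from the circle to
the line. -/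
lemma exists_sqInt_fc_eq {T : ℝ} (hT : 0 < T) {X : ℤ → ℂ} (hX : Memℓp X 2) :
    ∃ f, SqInt T f ∧ ∀ k, fc T f k = X k := by
  have : Fact (0 < T) := ⟨hT⟩
  let g := (@fourierBasis T _).repr.symm ⟨X, hX⟩
  refine ⟨fun t => g t, ?_, fun k => ?_⟩
  · have h1 : MemLp g 2 (volume : Measure (AddCircle T)) := (Lp.memLp g).of_haarAddCircle
    have := h1.comp_measurePreserving (AddCircle.measurePreserving_mk T 0)
    rw [zero_add] at this
    exact this
  · rw [← fc_eq_fourierCoeff, ← fourierBasis_repr]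
    simp [g]

lemma SqInt.integrable {T : ℝ} {f : ℝ → ℂ} (hf : SqInt T f) :
    Integrable f (volume.restrict (Ioc 0 T)) := MemLp.integrable (by norm_num) hf

lemma SqInt.integrable_mul {T : ℝ} {f g : ℝ → ℂ} (hf : SqInt T f) (hg : SqInt T g) :
    Integrable (fun t => f t * g t) (volume.restrict (Ioc 0 T)) :=
  MemLp.integrable_mul hf hg

lemma continuous_exp_mode (T : ℝ) (k : ℤ) :
    Continuous fun t : ℝ => Complex.exp (-(Complex.I * (2 * Real.pi / T : ℝ) * k * t)) := by
  fun_prop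

lemma norm_exp_mode (T : ℝ) (k : ℤ) (t : ℝ) :
    ‖Complex.exp (-(Complex.I * (2 * Real.pi / T : ℝ) * k * t))‖ = 1 := by
  have : (-(Complex.I * (2 * Real.pi / T : ℝ) * k * t)) =
      ((-(2 * Real.pi / T * k * t) : ℝ) : ℂ) * Complex.I := by push_cast; ring
  rw [this, Complex.norm_exp_ofReal_mul_I]

lemma intervalIntegrable_mul_exp_mode {T : ℝ} (hT : 0 < T) {f : ℝ → ℂ}
    (hf : Integrable f (volume.restrict (Ioc 0 T))) (k : ℤ) :
    IntervalIntegrable (fun τ : ℝ =>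
      f τ * Complex.exp (-(Complex.I * (2 * Real.pi / T : ℝ) * k * τ))) volume 0 T := by
  rw [intervalIntegrable_iff_integrableOn_Ioc_of_le hT.le]
  refine Integrable.mul_bdd (c := 1) hf (continuous_exp_mode T k).aestronglyMeasurable (.of_forall fun t => ?_)
  exact (norm_exp_mode T k t).le

lemma fc_add {T : ℝ} (hT : 0 < T) {f g : ℝ → ℂ}
    (hf : Integrable f (volume.restrict (Ioc 0 T)))
    (hg : Integrable g (volume.restrict (Ioc 0 T))) (k : ℤ) :
    fc T (fun t => f t + g t) k = fc T f k + fc T g k := by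
  unfold fc
  rw [← mul_add, ← intervalIntegral.integral_add (intervalIntegrable_mul_exp_mode hT hf k)
    (intervalIntegrable_mul_exp_mode hT hg k)]
  simp only [add_mul]

lemma fc_const_mul {T : ℝ} (c : ℂ) (f : ℝ → ℂ) (k : ℤ) :
    fc T (fun t => c * f t) k = c * fc T f k := by
  unfold fc
  simp only [mul_assoc]
  rw [intervalIntegral.integral_const_mul]
  ring

lemma fc_neg {T : ℝ} (f : ℝ → ℂ) (k : ℤ) : fc T (fun t => - f t) k = - fc T f k := by
  simpa using fc_const_mul (T := T) (-1) f k

lemma fc_sub {T : ℝ} (hT : 0 < T) {f g : ℝ → ℂ}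
    (hf : Integrable f (volume.restrict (Ioc 0 T)))
    (hg : Integrable g (volume.restrict (Ioc 0 T))) (k : ℤ) :
    fc T (fun t => f t - g t) k = fc T f k - fc T g k := by
  simpa [sub_eq_add_neg, fc_neg] using fc_add hT hf (g := fun t => - g t) hg.neg k

lemma fc_zero {T : ℝ} (k : ℤ) : fc T (fun _ => 0) k = 0 := by simp [fc]

lemma fc_sum {T : ℝ} (hT : 0 < T) {ι : Type*} (s : Finset ι) {f : ι → ℝ → ℂ}
    (hf : ∀ i ∈ s, Integrable (f i) (volume.restrict (Ioc 0 T))) (k : ℤ) :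
    fc T (fun t => ∑ i ∈ s, f i t) k = ∑ i ∈ s, fc T (f i) k := by
  classical
  induction s using Finset.induction_on with
  | empty => simp [fc_zero]
  | insert a s ha ih =>
    simp only [Finset.sum_insert ha]
    rw [fc_add hT (hf a (by simp)) (integrable_finsetSum _ fun i hi => hf i (by simp [hi])),
      ih fun i hi => hf i (by simp [hi])]

lemma conj_exp_mode (T : ℝ) (k : ℤ) (t : ℝ) :
    conj (Complex.exp (-(Complex.I * (2 * Real.pi / T : ℝ) * k * t))) =
      Complex.exp (-(Complex.I * (2 * Real.pi / T : ℝ) * (-k : ℤ) * t)) := by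
  rw [← Complex.exp_conj]
  congr 1
  simp only [map_neg, map_mul, Complex.conj_I, Complex.conj_ofReal, map_intCast]
  push_cast
  ring

lemma conj_fc {T : ℝ} (hT : 0 < T) (f : ℝ → ℂ) (k : ℤ) :
    conj (fc T f k) = fc T (fun t => conj (f t)) (-k) := by
  unfold fc
  rw [map_mul, intervalIntegral.integral_of_le hT.le, intervalIntegral.integral_of_le hT.le,
    ← integral_conj]
  simp only [map_mul, conj_exp_mode]
  simp

lemma fc_mul_exp_mode (T : ℝ) (f : ℝ → ℂ) (k l : ℤ) :
    fc T (fun t => f t * Complex.exp (-(Complex.I * (2 * Real.pi / T : ℝ) * l * t))) k =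
      fc T f (k + l) := by
  unfold fc
  congr 2
  ext t
  rw [mul_assoc, ← Complex.exp_add]
  congr 2
  push_cast
  ring

lemma SqInt.conj {T : ℝ} {f : ℝ → ℂ} (hf : SqInt T f) : SqInt T fun t => conj (f t) :=
  hf.star

lemma SqInt.mul_exp_mode {T : ℝ} {f : ℝ → ℂ} (hf : SqInt T f) (k : ℤ) :
    SqInt T fun t => f t * Complex.exp (-(Complex.I * (2 * Real.pi / T : ℝ) * k * t)) := by
  refine hf.mono (hf.1.mul (continuous_exp_mode T k).aestronglyMeasurable) (.of_forall fun t => ?_)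
  rw [norm_mul, norm_exp_mode, mul_one]

/-- The Fourier coefficients of a product are the convolution of the Fourier coefficients. -/
lemma hasSum_fc_mul {T : ℝ} (hT : 0 < T) {f g : ℝ → ℂ} (hf : SqInt T f) (hg : SqInt T g)
    (k : ℤ) :
    HasSum (fun l => fc T f (k - l) * fc T g l) (fc T (fun t => f t * g t) k) := by
  -- Parseval for `conj f · exp (jωkt)` and `g`: the `l`-th coefficient of the former is the
  -- conjugate of `f_{k-l}`.
  have h := hasSum_conj_fc_mul_fc hT (hf.conj.mul_exp_mode (-k)) hg
  convert h using 1
  · ext l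
    rw [fc_mul_exp_mode, conj_fc hT]
    simp only [Complex.conj_conj]
    congr 2
    ring
  · unfold fc
    congr 2
    ext t
    rw [map_mul, conj_exp_mode]
    simp only [Complex.conj_conj, neg_neg]
    ring

/-- A square integrable function is determined by its Fourier coefficients. -/
lemma ae_eq_of_fc_eq {T : ℝ} (hT : 0 < T) {f g : ℝ → ℂ} (hf : SqInt T f) (hg : SqInt T g)
    (h : ∀ k, fc T f k = fc T g k) : f =ᵐ[volume.restrict (Ioc 0 T)] g := by
  have : Fact (0 < T) := ⟨hT⟩
  have h1 : (memLp_lift hf).toLp = (memLp_lift hg).toLp := by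
    apply (@fourierBasis T _).repr.injective
    ext k
    rw [repr_toLp_lift hf, repr_toLp_lift hg, h]
  have h2 := (MemLp.toLp_eq_toLp_iff _ _).1 h1
  have h3 : AddCircle.liftIoc T 0 f =ᵐ[volume] AddCircle.liftIoc T 0 g := by
    rw [AddCircle.volume_eq_smul_haarAddCircle]
    exact Measure.ae_smul_measure h2 _
  have h4 := (AddCircle.measurePreserving_mk T 0).quasiMeasurePreserving.ae_eq_comp h3
  rw [zero_add] at h4
  exact (liftIoc_ae f).symm.trans (h4.trans (liftIoc_ae g))

/-! ### The dictionary between block sequences and vector functions. -/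

lemma hasSum_prod_fin {f : ℤ × Fin n → ℂ} {s : Fin n → ℂ}
    (h : ∀ a, HasSum (fun k => f (k, a)) (s a)) : HasSum f (∑ a, s a) := by
  classical
  have h1 : ∀ a, HasSum (fun p : ℤ × Fin n => if p.2 = a then f p else 0) (s a) := by
    intro a
    have hinj : Function.Injective fun k : ℤ => (k, a) := fun k l h => by simpa using h
    refine (hinj.hasSum_iff ?_).1 ?_
    · rintro ⟨k, b⟩ hx
      have : b ≠ a := fun hb => hx ⟨k, by simp [hb]⟩
      simp [this]
    · simpa [Function.comp_def] using h a
  have h2 := hasSum_sum (s := Finset.univ) fun a _ => h1 a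
  simpa using h2

lemma memlp_prod_fin {f : ℤ × Fin n → ℂ} (h : ∀ a, Memℓp (fun k => f (k, a)) 2) :
    Memℓp f 2 := by
  have h2 : (0 : ℝ) < (2 : ENNReal).toReal := by norm_num
  refine memℓp_gen ?_
  -- The norms are cast to `ℂ` only so that `hasSum_prod_fin` applies.
  have h3 : ∀ a, HasSum (fun k => ((‖f (k, a)‖ ^ (2 : ENNReal).toReal : ℝ) : ℂ))
      ((∑' k, ‖f (k, a)‖ ^ (2 : ENNReal).toReal : ℝ) : ℂ) := fun a =>
    Complex.hasSum_ofReal.2 ((memℓp_gen_iff h2).1 (h a)).hasSum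
  have := (hasSum_prod_fin (f := fun p => ((‖f p‖ ^ (2 : ENNReal).toReal : ℝ) : ℂ)) h3).summable
  exact Complex.summable_ofReal.1 this

lemma memlp_slice {f : ℤ × Fin n → ℂ} (h : Memℓp f 2) (a : Fin n) :
    Memℓp (fun k => f (k, a)) 2 := by
  have h2 : (0 : ℝ) < (2 : ENNReal).toReal := by norm_num
  rw [memℓp_gen_iff h2] at h ⊢
  exact h.comp_injective (i := fun k : ℤ => (k, a)) fun k l hkl => by simpa using hkl

/-- The sequence `X` consists of the Fourier coefficients of the square integrable vector
function `x`. -/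
structure Represents (T : ℝ) (X : EllTwo n) (x : ℝ → Fin n → ℂ) : Prop where
  sqInt : ∀ a, SqInt T fun t => x t a
  coeff : ∀ p, X p = fc T (fun t => x t p.2) p.1

lemma exists_function_represents {T : ℝ} (hT : 0 < T) (X : EllTwo n) :
    ∃ x, Represents T X x := by
  choose f hf hfc using fun a => exists_sqInt_fc_eq hT (memlp_slice X.2 a)
  exact ⟨fun t a => f a t, hf, fun p => (hfc p.2 p.1).symm⟩

lemma exists_sequence_represents {T : ℝ} (hT : 0 < T) {x : ℝ → Fin n → ℂ}
    (hx : ∀ a, SqInt T fun t => x t a) : ∃ X : EllTwo n, Represents T X x := by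
  have h : Memℓp (fun p : ℤ × Fin n => fc T (fun t => x t p.2) p.1) 2 := by
    refine memlp_prod_fin fun a => ?_
    have h1 := memlp_fc hT (hx a)
    exact h1
  let X : EllTwo n := ⟨fun p : ℤ × Fin n => fc T (fun t => x t p.2) p.1, h⟩
  have hX : ∀ p, X p = fc T (fun t => x t p.2) p.1 := fun p => by rfl
  exact ⟨X, hx, hX⟩

lemma Represents.congr_ae {T : ℝ} (hT : 0 < T) {X : EllTwo n} {x y : ℝ → Fin n → ℂ}
    (hx : Represents T X x) (h : x =ᵐ[volume.restrict (Ioc 0 T)] y) : Represents T X y := by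
  have h' : ∀ a, (fun t => x t a) =ᵐ[volume.restrict (Ioc 0 T)] fun t => y t a := fun a => by
    filter_upwards [h] with t ht using by rw [ht]
  exact ⟨fun a => (memLp_congr_ae (h' a)).1 (hx.sqInt a),
    fun p => (hx.coeff p).trans (fc_congr_ae hT (h' p.2) p.1)⟩

lemma Represents.eq_zero {T : ℝ} (hT : 0 < T) {X : EllTwo n} {x : ℝ → Fin n → ℂ}
    (hX : Represents T X x) (h : ∀ᵐ t ∂volume.restrict (Ioc 0 T), x t = 0) : X = 0 := by
  have := hX.congr_ae hT (y := fun _ => 0) h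
  ext p
  rw [this.coeff]
  simp [fc_zero]

lemma Represents.sum_smul {T : ℝ} (hT : 0 < T) {ι : Type*} (s : Finset ι) (c : ι → ℂ)
    {X : ι → EllTwo n} {x : ι → ℝ → Fin n → ℂ} (h : ∀ i, Represents T (X i) (x i)) :
    Represents T (∑ i ∈ s, c i • X i) fun t => ∑ i ∈ s, c i • x i t := by
  have h1 : ∀ i a, SqInt T fun t => c i * x i t a := fun i a => ((h i).sqInt a).const_mul (c i)
  refine ⟨fun a => ?_, fun p => ?_⟩
  · simpa using memLp_finsetSum s fun i _ => h1 i a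
  · simp only [Finset.sum_apply, Pi.smul_apply, smul_eq_mul]
    rw [fc_sum hT s fun i _ => (h1 i p.2).integrable]
    simp only [fc_const_mul, ← (h _).coeff]
    rw [lp.coeFn_sum]
    exact Finset.sum_apply p s _

/-- Parseval's identity for vector functions. -/
lemma Represents.inner_eq {T : ℝ} (hT : 0 < T) {X Y : EllTwo n} {x y : ℝ → Fin n → ℂ}
    (hX : Represents T X x) (hY : Represents T Y y) :
    inner ℂ X Y = (1 / (T : ℂ)) * ∫ t in (0 : ℝ)..T, star (x t) ⬝ᵥ y t := by
  refine (lp.hasSum_inner (𝕜 := ℂ) X Y).unique ?_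
  have h := hasSum_prod_fin (f := fun p => inner ℂ (X p) (Y p)) fun a => by
    simpa only [RCLike.inner_apply', hX.coeff, hY.coeff] using
      hasSum_conj_fc_mul_fc hT (hX.sqInt a) (hY.sqInt a)
  convert! h using 1
  rw [← Finset.mul_sum, ← intervalIntegral.integral_finsetSum]
  · simp [dotProduct]
  · intro a _
    rw [intervalIntegrable_iff_integrableOn_Ioc_of_le hT.le]
    exact (hX.sqInt a).conj.integrable_mul (hY.sqInt a)

/-! ### Block Toeplitz matrices as multiplication operators. -/

/-- The block Toeplitz matrix of a complex matrix function over the period `[0, T]`. -/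
noncomputable def toep (T : ℝ) (F : ℝ → Matrix (Fin n) (Fin n) ℂ) : BlockMatrix n :=
  fun p q => fc T (fun t => F t p.2 q.2) (p.1 - q.1)

/-- With `F` only square integrable, `F x` is merely integrable and its coefficients need not be
square summable; hence the sums are given one coordinate at a time. -/
lemma hasSum_toep_mulVec {T : ℝ} (hT : 0 < T) {F : ℝ → Matrix (Fin n) (Fin n) ℂ}
    (hF : ∀ a b, SqInt T fun t => F t a b) {X : EllTwo n} {x : ℝ → Fin n → ℂ}
    (hX : Represents T X x) (p : ℤ × Fin n) :
    HasSum (fun q => toep T F p q * X q) (fc T (fun t => (F t *ᵥ x t) p.2) p.1) := by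
  have h := hasSum_prod_fin (f := fun q => toep T F p q * X q) fun b => by
    simpa only [toep, hX.coeff] using hasSum_fc_mul hT (hF p.2 b) (hX.sqInt b) p.1
  rwa [← fc_sum hT _ fun b _ => (hF p.2 b).integrable_mul (hX.sqInt b)] at h

lemma actsTo_toep {T : ℝ} (hT : 0 < T) {F : ℝ → Matrix (Fin n) (Fin n) ℂ}
    (hF : ∀ a b, SqInt T fun t => F t a b) {X Y : EllTwo n} {x : ℝ → Fin n → ℂ}
    (hX : Represents T X x) (hY : Represents T Y fun t => F t *ᵥ x t) :
    ActsTo (toep T F) X Y := fun p => by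
  rw [hY.coeff]
  exact hasSum_toep_mulVec hT hF hX p

lemma hasSum_toep_mul {T : ℝ} (hT : 0 < T) {F G : ℝ → Matrix (Fin n) (Fin n) ℂ}
    (hF : ∀ a b, SqInt T fun t => F t a b) (hG : ∀ a b, SqInt T fun t => G t a b)
    (p q : ℤ × Fin n) :
    HasSum (fun r => toep T F p r * toep T G r q) (toep T (fun t => F t * G t) p q) := by
  have h := hasSum_prod_fin (f := fun r => toep T F p r * toep T G r q) fun b => by
    have h1 := hasSum_fc_mul hT (hF p.2 b) (hG b q.2) (p.1 - q.1)
    rw [← (Equiv.subRight q.1).hasSum_iff] at h1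
    simpa only [toep, Function.comp_def, Equiv.subRight_apply, sub_sub_sub_cancel_right] using h1
  rwa [← fc_sum hT _ fun b _ => (hF p.2 b).integrable_mul (hG b q.2)] at h

lemma conjTranspose_toep {T : ℝ} (hT : 0 < T) (F : ℝ → Matrix (Fin n) (Fin n) ℂ) :
    (toep T F)ᴴ = toep T fun t => (F t)ᴴ := by
  ext p q
  simp only [conjTranspose_apply, toep]
  rw [← starRingEnd_apply, conj_fc hT]
  simp

lemma toep_congr_ae {T : ℝ} (hT : 0 < T) {F G : ℝ → Matrix (Fin n) (Fin n) ℂ}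
    (h : F =ᵐ[volume.restrict (Ioc 0 T)] G) : toep T F = toep T G := by
  ext p q
  refine fc_congr_ae hT ?_ _
  filter_upwards [h] with t ht using by rw [ht]

lemma toep_injective {T : ℝ} (hT : 0 < T) {F G : ℝ → Matrix (Fin n) (Fin n) ℂ}
    (hF : ∀ a b, SqInt T fun t => F t a b) (hG : ∀ a b, SqInt T fun t => G t a b)
    (h : toep T F = toep T G) : F =ᵐ[volume.restrict (Ioc 0 T)] G := by
  have h1 : ∀ a b, (fun t => F t a b) =ᵐ[volume.restrict (Ioc 0 T)] fun t => G t a b :=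
    fun a b => ae_eq_of_fc_eq hT (hF a b) (hG a b) fun k => by
      simpa [toep] using congrFun (congrFun h (k, a)) (0, b)
  have h2 := ae_all_iff.2 fun a => ae_all_iff.2 fun b => h1 a b
  filter_upwards [h2] with t ht
  ext a b
  exact ht a b

lemma ActsTo.unique {M : BlockMatrix n} {X Y Z : EllTwo n} (hY : ActsTo M X Y)
    (hZ : ActsTo M X Z) : Y = Z := by
  ext p
  exact (hY p).unique (hZ p)

/-- An everywhere defined matrix with square summable rows defines a bounded operator. -/
lemma isBoundedOnEllTwo_of_forall_exists {M : BlockMatrix n} (hrow : ∀ p, Memℓp (M p) 2)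
    (h : ∀ X, ∃ Y, ActsTo M X Y) : IsBoundedOnEllTwo M := by
  choose f hf using h
  let g : EllTwo n →ₗ[ℂ] EllTwo n :=
    { toFun := f
      map_add' := fun X Y => (hf (X + Y)).unique fun p => by
        simpa [mul_add] using (hf X p).add (hf Y p)
      map_smul' := fun c X => (hf (c • X)).unique fun p => by
        simpa [mul_left_comm] using (hf X p).mul_left c }
  -- Each coordinate of `M X` is an inner product with a fixed vector, hence continuous in `X`; this
  -- closes the graph.
  let row : ℤ × Fin n → EllTwo n := fun p => ⟨fun q => star (M p q), (hrow p).star_mem⟩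
  have hrow' : ∀ p X, inner ℂ (row p) X = f X p := fun p X => by
    refine (lp.hasSum_inner (𝕜 := ℂ) (row p) X).unique ?_
    simpa [row, mul_comm] using hf X p
  refine ⟨⟨g, g.continuous_of_seq_closed_graph fun u x y hu hgu => ?_⟩, hf⟩
  ext p
  have h1 : Filter.Tendsto (fun m => inner ℂ (row p) (u m)) Filter.atTop
      (nhds (inner ℂ (row p) x)) := tendsto_const_nhds.inner hu
  have h2 : Filter.Tendsto (fun m => (g (u m)) p) Filter.atTop (nhds (y p)) := by
    have := (lp.evalCLM ℂ (fun _ : ℤ × Fin n => ℂ) (2 : ENNReal) p).continuous.tendsto y |>.comp hgu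
    exact this
  simp only [hrow'] at h1
  exact tendsto_nhds_unique h2 h1

lemma memlp_row_toep {T : ℝ} (hT : 0 < T) {F : ℝ → Matrix (Fin n) (Fin n) ℂ}
    (hF : ∀ a b, SqInt T fun t => F t a b) (p : ℤ × Fin n) : Memℓp (toep T F p) 2 := by
  refine memlp_prod_fin fun b => ?_
  have h2 : (0 : ℝ) < (2 : ENNReal).toReal := by norm_num
  have := memlp_fc hT (hF p.2 b)
  rw [memℓp_gen_iff h2] at this ⊢
  exact this.comp_injective (i := fun k : ℤ => p.1 - k) fun k l hkl => by simpa using hkl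

lemma memLp_mul_top {T : ℝ} {f g : ℝ → ℂ} (hf : MemLp f ⊤ (volume.restrict (Ioc 0 T)))
    (hg : SqInt T g) : SqInt T fun t => f t * g t :=
  MemLp.mul' (p := ⊤) (q := 2) (r := 2) hg hf

lemma sqInt_of_top {T : ℝ} {f : ℝ → ℂ} (hf : MemLp f ⊤ (volume.restrict (Ioc 0 T))) :
    SqInt T f := hf.mono_exponent le_top

lemma sqInt_mulVec {T : ℝ} {F : ℝ → Matrix (Fin n) (Fin n) ℂ}
    (hF : ∀ a b, MemLp (fun t => F t a b) ⊤ (volume.restrict (Ioc 0 T)))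
    {x : ℝ → Fin n → ℂ} (hx : ∀ a, SqInt T fun t => x t a) (a : Fin n) :
    SqInt T fun t => (F t *ᵥ x t) a := by
  simpa [mulVec, dotProduct] using
    memLp_finsetSum Finset.univ fun b _ => memLp_mul_top (hF a b) (hx b)

lemma exists_actsTo_toep {T : ℝ} (hT : 0 < T) {F : ℝ → Matrix (Fin n) (Fin n) ℂ}
    (hF : ∀ a b, MemLp (fun t => F t a b) ⊤ (volume.restrict (Ioc 0 T)))
    {X : EllTwo n} {x : ℝ → Fin n → ℂ} (hX : Represents T X x) :
    ∃ Y, ActsTo (toep T F) X Y ∧ Represents T Y fun t => F t *ᵥ x t := by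
  obtain ⟨Y, hY⟩ := exists_sequence_represents hT (sqInt_mulVec hF hX.sqInt)
  exact ⟨Y, actsTo_toep hT (fun a b => sqInt_of_top (hF a b)) hX hY, hY⟩

lemma isBoundedOnEllTwo_toep {T : ℝ} (hT : 0 < T) {F : ℝ → Matrix (Fin n) (Fin n) ℂ}
    (hF : ∀ a b, MemLp (fun t => F t a b) ⊤ (volume.restrict (Ioc 0 T))) :
    IsBoundedOnEllTwo (toep T F) := by
  refine isBoundedOnEllTwo_of_forall_exists
    (memlp_row_toep hT fun a b => sqInt_of_top (hF a b)) fun X => ?_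
  obtain ⟨x, hx⟩ := exists_function_represents hT X
  obtain ⟨Y, hY, -⟩ := exists_actsTo_toep hT hF hx
  exact ⟨Y, hY⟩

lemma integrable_star_dotProduct {T : ℝ} {x y : ℝ → Fin n → ℂ}
    (hx : ∀ a, SqInt T fun t => x t a) (hy : ∀ a, SqInt T fun t => y t a) :
    Integrable (fun t => star (x t) ⬝ᵥ y t) (volume.restrict (Ioc 0 T)) := by
  simpa [dotProduct] using
    integrable_finsetSum Finset.univ fun a _ => (hx a).conj.integrable_mul (hy a)

lemma Represents.re_inner_eq {T : ℝ} (hT : 0 < T) {X Y : EllTwo n} {x y : ℝ → Fin n → ℂ}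
    (hX : Represents T X x) (hY : Represents T Y y) :
    (inner ℂ X Y).re = (1 / T) * ∫ t in Ioc 0 T, (star (x t) ⬝ᵥ y t).re := by
  rw [hX.inner_eq hT hY, intervalIntegral.integral_of_le hT.le]
  have h := integral_re (integrable_star_dotProduct hX.sqInt hY.sqInt)
  simp only [RCLike.re_to_complex] at h
  rw [h, ← Complex.re_ofReal_mul]
  push_cast
  rfl

/-- By Parseval the form is the mean of `x^* F x ≥ 0`; if that mean vanishes, so does the integrand
almost everywhere, and then `x = 0`. -/
lemma isPositiveDefinite_toep {T : ℝ} (hT : 0 < T) {F : ℝ → Matrix (Fin n) (Fin n) ℂ}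
    (hF : ∀ a b, MemLp (fun t => F t a b) ⊤ (volume.restrict (Ioc 0 T)))
    (hpos : ∀ᵐ t ∂volume.restrict (Ioc 0 T), (F t).PosDef) :
    IsPositiveDefinite (toep T F) := by
  intro X Y hXY hX0
  obtain ⟨x, hx⟩ := exists_function_represents hT X
  obtain ⟨Z, hZ, hZr⟩ := exists_actsTo_toep hT hF hx
  obtain rfl := hXY.unique hZ
  rw [hx.re_inner_eq hT hZr]
  have hnn : 0 ≤ᵐ[volume.restrict (Ioc 0 T)] fun t => (star (x t) ⬝ᵥ (F t *ᵥ x t)).re := by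
    filter_upwards [hpos] with t ht
    exact (Complex.le_def.1 (ht.posSemidef.dotProduct_mulVec_nonneg (x t))).1
  have hint : Integrable (fun t => (star (x t) ⬝ᵥ (F t *ᵥ x t)).re)
      (volume.restrict (Ioc 0 T)) := (integrable_star_dotProduct hx.sqInt hZr.sqInt).re
  refine mul_pos (by positivity) (lt_of_le_of_ne (integral_nonneg_of_ae hnn) fun h0 => hX0 ?_)
  have h1 := (integral_eq_zero_iff_of_nonneg_ae hnn hint).1 h0.symm
  refine hx.eq_zero hT ?_
  filter_upwards [h1, hpos] with t ht htp
  by_contra hne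
  exact (Complex.lt_def.1 (htp.dotProduct_mulVec_pos hne)).1.ne' ht

/-! ### Absolutely continuous complex and matrix functions. -/

lemma absolutelyContinuous_of_dist_le {X Y : Type*} [PseudoMetricSpace X] [PseudoMetricSpace Y]
    {f : ℝ → X} {g : ℝ → Y} {a b : ℝ} (hf : AbsolutelyContinuousOnInterval f a b)
    (h : ∀ s t, dist (g s) (g t) ≤ dist (f s) (f t)) : AbsolutelyContinuousOnInterval g a b :=
  squeeze_zero (fun _ => Finset.sum_nonneg fun _ _ => dist_nonneg)
    (fun _ => Finset.sum_le_sum fun _ _ => h _ _) hf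

lemma absolutelyContinuous_const {X : Type*} [PseudoMetricSpace X] (c : X) (a b : ℝ) :
    AbsolutelyContinuousOnInterval (fun _ => c) a b := by
  simpa [AbsolutelyContinuousOnInterval] using tendsto_const_nhds

lemma absolutelyContinuous_ofReal {f : ℝ → ℝ} {a b : ℝ}
    (hf : AbsolutelyContinuousOnInterval f a b) :
    AbsolutelyContinuousOnInterval (fun t => (f t : ℂ)) a b :=
  absolutelyContinuous_of_dist_le hf fun _ _ => (Complex.isometry_ofReal.dist_eq _ _).le

/-- Reduces to the real theorem on real and imaginary parts. The splitting of the integral is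
available only for endpoints in the interval, so the transfer goes through the `ε`-`δ` form. -/
lemma absolutelyContinuous_primitive {f : ℝ → ℂ} {a b : ℝ}
    (hf : IntervalIntegrable f volume a b) :
    AbsolutelyContinuousOnInterval (fun s => ∫ t in a..s, f t) a b := by
  have hre : IntervalIntegrable (fun t => (f t).re) volume a b :=
    ⟨hf.1.re, hf.2.re⟩
  have him : IntervalIntegrable (fun t => (f t).im) volume a b :=
    ⟨hf.1.im, hf.2.im⟩
  have h1 := absolutelyContinuous_ofReal
    (hre.absolutelyContinuousOnInterval_intervalIntegral left_mem_uIcc)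
  have h2 := absolutelyContinuous_ofReal
    (him.absolutelyContinuousOnInterval_intervalIntegral left_mem_uIcc)
  have h3 := h1.fun_add (h2.const_smul Complex.I)
  have key : ∀ s ∈ uIcc a b, ∫ t in a..s, f t =
      ((∫ t in a..s, (f t).re : ℝ) : ℂ) + Complex.I • ((∫ t in a..s, (f t).im : ℝ) : ℂ) := by
    intro s hs
    have hsub : uIcc a s ⊆ uIcc a b := uIcc_subset_uIcc left_mem_uIcc hs
    rw [← intervalIntegral.integral_ofReal, ← intervalIntegral.integral_ofReal, smul_eq_mul,
      ← intervalIntegral.integral_const_mul, ← intervalIntegral.integral_add]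
    · refine intervalIntegral.integral_congr fun t _ => ?_
      simp only [mul_comm Complex.I]
      exact (Complex.re_add_im (f t)).symm
    · exact ⟨(hre.mono_set hsub).1.ofReal, (hre.mono_set hsub).2.ofReal⟩
    · exact IntervalIntegrable.const_mul
        ⟨(him.mono_set hsub).1.ofReal, (him.mono_set hsub).2.ofReal⟩ _
  rw [absolutelyContinuousOnInterval_iff] at h3 ⊢
  intro ε hε
  obtain ⟨δ, hδ, h⟩ := h3 ε hε
  refine ⟨δ, hδ, fun E hE hlt => ?_⟩
  convert h E hE hlt using 3 with i hi
  · exact key _ (hE.1 i hi).1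
  · exact key _ (hE.1 i hi).2

/-- `f` is absolutely continuous on `[0, T]` with integrable almost everywhere derivative `f'`. -/
structure HasACDeriv (T : ℝ) (f f' : ℝ → ℂ) : Prop where
  ac : AbsolutelyContinuousOnInterval f 0 T
  deriv : ∀ᵐ t ∂volume.restrict (Ioc 0 T), HasDerivAt f (f' t) t
  int : Integrable f' (volume.restrict (Ioc 0 T))

namespace HasACDeriv

variable {T : ℝ} {f f' g g' : ℝ → ℂ}

lemma intervalIntegrable (hT : 0 < T) (hf : HasACDeriv T f f') :
    IntervalIntegrable f' volume 0 T := by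
  rw [intervalIntegrable_iff_integrableOn_Ioc_of_le hT.le]
  exact hf.int

lemma ae_deriv (hT : 0 < T) (hf : HasACDeriv T f f') :
    ∀ᵐ t, t ∈ uIcc 0 T → HasDerivAt f (f' t) t := by
  have h := hf.deriv
  rw [ae_restrict_iff' measurableSet_Ioc] at h
  -- Dropping the null point `0` passes from the half-open to the closed interval.
  have h0 : ∀ᵐ t : ℝ, t ≠ 0 := by simp [ae_iff, measure_singleton]
  filter_upwards [h, h0] with t ht h0 hm
  rw [uIcc_of_le hT.le] at hm
  exact ht ⟨lt_of_le_of_ne hm.1 h0.symm, hm.2⟩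

lemma congr_deriv (hf : HasACDeriv T f f') (h : f' =ᵐ[volume.restrict (Ioc 0 T)] g') :
    HasACDeriv T f g' where
  ac := hf.ac
  deriv := by filter_upwards [hf.deriv, h] with t h1 h2 using h2 ▸ h1
  int := hf.int.congr h

/-- The fundamental theorem of calculus. -/
lemma eq_add_integral (hT : 0 < T) (hf : HasACDeriv T f f') {s : ℝ} (hs : s ∈ Icc 0 T) :
    f s = f 0 + ∫ t in (0 : ℝ)..s, f' t := by
  have h1 := absolutelyContinuous_primitive (hf.intervalIntegrable hT)
  have h2 := hf.ac.fun_sub h1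
  -- `f` minus the primitive of `f'` is absolutely continuous with zero derivative almost
  -- everywhere, hence constant.
  obtain ⟨C, hC⟩ := h2.const_of_ae_hasDerivAt_zero (by
    filter_upwards [hf.ae_deriv hT, (hf.intervalIntegrable hT).ae_hasDerivAt_integral]
      with t ht1 ht2 hm
    simpa using (ht1 hm).fun_sub (ht2 hm 0 left_mem_uIcc))
  rw [uIcc_of_le hT.le] at hC
  have e1 := hC s hs
  have e2 := hC 0 ⟨le_rfl, hT.le⟩
  simp only [intervalIntegral.integral_same, sub_zero] at e2
  rw [e2, ← e1]
  ring

lemma integral_eq (hT : 0 < T) (hf : HasACDeriv T f f') {a b : ℝ} (ha : a ∈ Icc 0 T)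
    (hb : b ∈ Icc 0 T) : ∫ t in a..b, f' t = f b - f a := by
  have hi := hf.intervalIntegrable hT
  have hsub : ∀ {c}, c ∈ Icc 0 T → IntervalIntegrable f' volume 0 c := fun {c} hc =>
    hi.mono_set (uIcc_subset_uIcc left_mem_uIcc (by rwa [uIcc_of_le hT.le]))
  rw [hf.eq_add_integral hT ha, hf.eq_add_integral hT hb,
    ← intervalIntegral.integral_interval_sub_left (hsub hb) (hsub ha)]
  ring

lemma continuousOn (hT : 0 < T) (hf : HasACDeriv T f f') : ContinuousOn f (Icc 0 T) := by
  have := hf.ac.continuousOn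
  rwa [uIcc_of_le hT.le] at this

lemma aestronglyMeasurable (hT : 0 < T) (hf : HasACDeriv T f f') :
    AEStronglyMeasurable f (volume.restrict (Ioc 0 T)) :=
  ((hf.continuousOn hT).mono Ioc_subset_Icc_self).aestronglyMeasurable measurableSet_Ioc

lemma memLp_top (hT : 0 < T) (hf : HasACDeriv T f f') :
    MemLp f ⊤ (volume.restrict (Ioc 0 T)) := by
  obtain ⟨C, hC⟩ := hf.ac.exists_bound
  refine memLp_top_of_bound (hf.aestronglyMeasurable hT) C ?_
  rw [ae_restrict_iff' measurableSet_Ioc]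
  refine .of_forall fun t ht => hC t ?_
  rw [uIcc_of_le hT.le]
  exact Ioc_subset_Icc_self ht

lemma sqInt (hT : 0 < T) (hf : HasACDeriv T f f') : SqInt T f := sqInt_of_top (hf.memLp_top hT)

lemma of_integrable (hT : 0 < T) (c : ℂ) (hf : Integrable f' (volume.restrict (Ioc 0 T))) :
    HasACDeriv T (fun s => c + ∫ t in (0 : ℝ)..s, f' t) f' := by
  have hi : IntervalIntegrable f' volume 0 T := by
    rwa [intervalIntegrable_iff_integrableOn_Ioc_of_le hT.le]
  refine ⟨(absolutelyContinuous_const c 0 T).fun_add (absolutelyContinuous_primitive hi), ?_, hf⟩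
  rw [ae_restrict_iff' measurableSet_Ioc]
  filter_upwards [hi.ae_hasDerivAt_integral] with t ht hm
  refine (ht ?_ 0 left_mem_uIcc).const_add c
  rw [uIcc_of_le hT.le]
  exact Ioc_subset_Icc_self hm

lemma mul (hT : 0 < T) (hf : HasACDeriv T f f') (hg : HasACDeriv T g g') :
    HasACDeriv T (fun t => f t * g t) (fun t => f' t * g t + f t * g' t) where
  ac := hf.ac.smul hg.ac
  deriv := by filter_upwards [hf.deriv, hg.deriv] with t h1 h2 using h1.mul h2
  int := by
    obtain ⟨C, hC⟩ := hf.ac.exists_bound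
    obtain ⟨D, hD⟩ := hg.ac.exists_bound
    rw [uIcc_of_le hT.le] at hC hD
    refine (hf.int.mul_bdd (c := D) (hg.aestronglyMeasurable hT) ?_).add
      (hg.int.bdd_mul (c := C) (hf.aestronglyMeasurable hT) ?_) <;>
    rw [ae_restrict_iff' measurableSet_Ioc]
    · exact .of_forall fun t ht => hD t (Ioc_subset_Icc_self ht)
    · exact .of_forall fun t ht => hC t (Ioc_subset_Icc_self ht)

lemma add (hf : HasACDeriv T f f') (hg : HasACDeriv T g g') :
    HasACDeriv T (fun t => f t + g t) (fun t => f' t + g' t) where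
  ac := hf.ac.fun_add hg.ac
  deriv := by filter_upwards [hf.deriv, hg.deriv] with t h1 h2 using h1.add h2
  int := hf.int.add hg.int

lemma const (c : ℂ) : HasACDeriv T (fun _ => c) (fun _ => 0) where
  ac := absolutelyContinuous_const c 0 T
  deriv := .of_forall fun t => hasDerivAt_const t c
  int := integrable_zero _ _ _

lemma sum {ι : Type*} (s : Finset ι) {f f' : ι → ℝ → ℂ}
    (h : ∀ i ∈ s, HasACDeriv T (f i) (f' i)) :
    HasACDeriv T (fun t => ∑ i ∈ s, f i t) (fun t => ∑ i ∈ s, f' i t) := by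
  classical
  induction s using Finset.induction_on with
  | empty => simpa using const 0
  | insert a s ha ih =>
    simpa [Finset.sum_insert ha] using (h a (by simp)).add (ih fun i hi => h i (by simp [hi]))

lemma star (hf : HasACDeriv T f f') :
    HasACDeriv T (fun t => Star.star (f t)) (fun t => Star.star (f' t)) where
  ac := absolutelyContinuous_of_dist_le hf.ac fun s t => (dist_star_star _ _).le
  deriv := by filter_upwards [hf.deriv] with t h1 using h1.star
  int := (Complex.conjLIE.toContinuousLinearEquiv.toContinuousLinearMap).integrable_comp hf.int

lemma of_contDiff (hT : 0 < T) (hf : ContDiff ℝ 1 f) (h : ∀ t, HasDerivAt f (f' t) t) :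
    HasACDeriv T f f' where
  ac := hf.contDiffOn.absolutelyContinuousOnInterval
  deriv := .of_forall h
  int := by
    have : f' = _root_.deriv f := funext fun t => (h t).deriv.symm
    rw [this]
    have h2 := (hf.continuous_deriv le_rfl).intervalIntegrable (μ := volume) 0 T
    rwa [intervalIntegrable_iff_integrableOn_Ioc_of_le hT.le] at h2

lemma exp_mode (hT : 0 < T) (k : ℤ) :
    HasACDeriv T (fun t : ℝ => Complex.exp (-(Complex.I * (2 * Real.pi / T : ℝ) * k * t)))
      fun t => -(Complex.I * (2 * Real.pi / T : ℝ) * k) *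
        Complex.exp (-(Complex.I * (2 * Real.pi / T : ℝ) * k * t)) := by
  refine of_contDiff hT ?_ fun t => ?_
  · have : ContDiff ℝ 1 fun t : ℝ => (t : ℂ) := Complex.ofRealCLM.contDiff
    fun_prop
  · have h1 : HasDerivAt (fun t : ℝ => -(Complex.I * (2 * Real.pi / T : ℝ) * k * t))
        (-(Complex.I * (2 * Real.pi / T : ℝ) * k)) t := by
      simpa using ((Complex.ofRealCLM.hasDerivAt (x := t)).const_mul
        (Complex.I * (2 * Real.pi / T : ℝ) * k)).fun_neg
    simpa [mul_comm] using h1.cexp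

/-- The Fourier coefficients of the derivative of a function with equal boundary values. -/
lemma fc_deriv (hT : 0 < T) (hf : HasACDeriv T f f') (h0 : f 0 = f T) (k : ℤ) :
    fc T f' k = Complex.I * (2 * Real.pi / T : ℝ) * k * fc T f k := by
  -- Integration by parts: the derivative of `f · exp (-jωkt)` integrates to zero because the
  -- boundary values agree.
  have h1 := (hf.mul hT (exp_mode hT k)).integral_eq hT (a := 0) (b := T)
    ⟨le_rfl, hT.le⟩ ⟨hT.le, le_rfl⟩
  have hper : Complex.exp (-(Complex.I * (2 * Real.pi / T : ℝ) * k * T)) = 1 := by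
    rw [← fourier_neg_eq_exp, AddCircle.coe_period]
    simp
  rw [hper, ← h0] at h1
  simp only [Complex.ofReal_zero, mul_zero, neg_zero, Complex.exp_zero, sub_self] at h1
  rw [intervalIntegral.integral_add (intervalIntegrable_mul_exp_mode hT hf.int k)] at h1
  · have h2 : ∀ t : ℝ, f t * (-(Complex.I * (2 * Real.pi / T : ℝ) * k) *
        Complex.exp (-(Complex.I * (2 * Real.pi / T : ℝ) * k * t))) =
        -(Complex.I * (2 * Real.pi / T : ℝ) * k) *
        (f t * Complex.exp (-(Complex.I * (2 * Real.pi / T : ℝ) * k * t))) := fun t => by ring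
    simp only [h2] at h1
    rw [intervalIntegral.integral_const_mul] at h1
    unfold fc
    linear_combination (1 / (T : ℂ)) * h1
  · have h3 := (intervalIntegrable_mul_exp_mode hT (hf.sqInt hT).integrable k).const_mul
      (-(Complex.I * (2 * Real.pi / T : ℝ) * k))
    convert h3 using 2
    ring

end HasACDeriv

/-- Entrywise absolute continuity of matrix functions on `[0, T]`. -/
def MatACDeriv (T : ℝ) (F F' : ℝ → Matrix (Fin n) (Fin n) ℂ) : Prop :=
  ∀ i j, HasACDeriv T (fun t => F t i j) fun t => F' t i j

namespace MatACDeriv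

variable {T : ℝ} {F F' G G' : ℝ → Matrix (Fin n) (Fin n) ℂ}

lemma mul (hT : 0 < T) (hF : MatACDeriv T F F') (hG : MatACDeriv T G G') :
    MatACDeriv T (fun t => F t * G t) fun t => F' t * G t + F t * G' t := by
  intro i j
  simpa [Matrix.mul_apply, Finset.sum_add_distrib] using
    HasACDeriv.sum Finset.univ fun l _ => (hF i l).mul hT (hG l j)

lemma const (C : Matrix (Fin n) (Fin n) ℂ) : MatACDeriv T (fun _ => C) fun _ => 0 :=
  fun i j => HasACDeriv.const (C i j)

lemma congr_deriv (hF : MatACDeriv T F F') (h : F' =ᵐ[volume.restrict (Ioc 0 T)] G') :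
    MatACDeriv T F G' := fun i j => (hF i j).congr_deriv (by
  filter_upwards [h] with t ht using by rw [ht])

lemma conjTranspose (hF : MatACDeriv T F F') :
    MatACDeriv T (fun t => (F t)ᴴ) fun t => (F' t)ᴴ :=
  fun i j => (hF j i).star

lemma eq_of_deriv_zero (hT : 0 < T) (hF : MatACDeriv T F fun _ => 0) {s : ℝ}
    (hs : s ∈ Icc 0 T) : F s = F 0 := by
  ext i j
  simpa using (hF i j).eq_add_integral hT hs

end MatACDeriv

/-! ### Linear differential equations with integrable coefficients. -/

section Volterra

variable {𝔸 : Type*} [NormedRing 𝔸] [NormedAlgebra ℝ 𝔸]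

/-- The terms of the Dyson series of the linear equation `Y' = a Y`. -/
noncomputable def dyson (a : ℝ → 𝔸) : ℕ → ℝ → 𝔸
  | 0 => fun _ => 1
  | m + 1 => fun t => ∫ s in (0 : ℝ)..t, a s * dyson a m s

lemma continuous_dyson {a : ℝ → 𝔸} (ha : Integrable a) (m : ℕ) : Continuous (dyson a m) := by
  induction m with
  | zero => exact continuous_const
  | succ m ih =>
    refine intervalIntegral.continuous_primitive (fun b c => ?_) 0
    exact ha.intervalIntegrable.mul_continuousOn ih.continuousOn

/-- The power of the primitive is absolutely continuous, so the chain rule almost everywhere can be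
integrated. -/
lemma integral_mul_primitive_pow {u : ℝ → ℝ} (hu : Integrable u) (m : ℕ) (t : ℝ) :
    ∫ s in (0 : ℝ)..t, u s * (∫ r in (0 : ℝ)..s, u r) ^ m =
      (∫ r in (0 : ℝ)..t, u r) ^ (m + 1) / (m + 1) := by
  have hac : AbsolutelyContinuousOnInterval (fun s => ∫ r in (0 : ℝ)..s, u r) 0 t :=
    hu.intervalIntegrable.absolutelyContinuousOnInterval_intervalIntegral left_mem_uIcc
  have hpow : ∀ m : ℕ, AbsolutelyContinuousOnInterval
      (fun s => (∫ r in (0 : ℝ)..s, u r) ^ m) 0 t := by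
    intro m
    induction m with
    | zero => simpa using absolutelyContinuous_const (1 : ℝ) 0 t
    | succ m ih => simpa [pow_succ] using ih.fun_mul hac
  have h := (hpow (m + 1)).integral_deriv_eq_sub
  have hd : ∀ᵐ s, deriv (fun s => (∫ r in (0 : ℝ)..s, u r) ^ (m + 1)) s =
      (m + 1) * (u s * (∫ r in (0 : ℝ)..s, u r) ^ m) := by
    filter_upwards [LocallyIntegrable.ae_hasDerivAt_integral hu.locallyIntegrable] with s hs
    rw [((hs 0).fun_pow (m + 1)).deriv]
    push_cast

    ring
  rw [intervalIntegral.integral_congr_ae (hd.mono fun s hs _ => hs),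
    intervalIntegral.integral_const_mul] at h
  have hm : (m + 1 : ℝ) ≠ 0 := by positivity
  rw [eq_div_iff hm, mul_comm, h]
  simp

/-- The factorial makes the Dyson series converge whatever the size of `∫ ‖a‖`. The factor `‖1‖`
stays because the unit is not assumed to have norm one. -/
lemma norm_dyson_le {a : ℝ → 𝔸} (ha : Integrable a) (m : ℕ) {t : ℝ} (ht : 0 ≤ t) :
    ‖dyson a m t‖ ≤ ‖(1 : 𝔸)‖ * ((∫ s in (0 : ℝ)..t, ‖a s‖) ^ m / m.factorial) := by
  induction m generalizing t with
  | zero => simp [dyson]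
  | succ m ih =>
    have hcont : Continuous fun s => ∫ r in (0 : ℝ)..s, ‖a r‖ :=
      intervalIntegral.continuous_primitive (fun b c => ha.norm.intervalIntegrable) 0
    have h1 : ‖dyson a (m + 1) t‖ ≤ ∫ s in (0 : ℝ)..t,
        (‖(1 : 𝔸)‖ / m.factorial) * (‖a s‖ * (∫ r in (0 : ℝ)..s, ‖a r‖) ^ m) := by
      refine intervalIntegral.norm_integral_le_of_norm_le ht (.of_forall fun s hs => ?_) ?_
      · calc ‖a s * dyson a m s‖ ≤ ‖a s‖ * ‖dyson a m s‖ := norm_mul_le _ _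
          _ ≤ ‖a s‖ * (‖(1 : 𝔸)‖ * ((∫ r in (0 : ℝ)..s, ‖a r‖) ^ m / m.factorial)) := by
            gcongr
            exact ih hs.1.le
          _ = _ := by ring
      · exact (ha.norm.intervalIntegrable.mul_continuousOn (hcont.pow m).continuousOn).const_mul _
    refine h1.trans (le_of_eq ?_)
    rw [intervalIntegral.integral_const_mul, integral_mul_primitive_pow ha.norm,
      Nat.factorial_succ]
    have h3 : (m.factorial : ℝ) ≠ 0 := by positivity
    push_cast
    field_simp

variable [CompleteSpace 𝔸]

/-- Existence of a solution of `Y' = a Y`, `Y 0 = 1`, in integrated form. -/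
lemma exists_volterra_solution {a : ℝ → 𝔸} {T : ℝ} (hT : 0 < T)
    (ha : Integrable a (volume.restrict (Ioc 0 T))) :
    ∃ Y : ℝ → 𝔸, (∀ t ∈ Icc 0 T, Y t = 1 + ∫ s in (0 : ℝ)..t, a s * Y s) ∧
      Integrable (fun s => a s * Y s) (volume.restrict (Ioc 0 T)) := by
  -- Cutting `a` off outside the period makes all Dyson terms continuous on the whole line.
  wlog hint : Integrable a generalizing a
  · have ha' : Integrable (indicator (Ioc 0 T) a) := (integrable_indicator_iff measurableSet_Ioc).2 ha
    obtain ⟨Y, hY, hYi⟩ := this (a := indicator (Ioc 0 T) a) ha'.restrict ha'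
    refine ⟨Y, fun t ht => ?_, hYi.congr ?_⟩
    · rw [hY t ht]
      congr 1
      refine intervalIntegral.integral_congr_ae (.of_forall fun s hs => ?_)
      rw [uIoc_of_le ht.1] at hs
      simp [indicator_of_mem (show s ∈ Ioc 0 T from ⟨hs.1, hs.2.trans ht.2⟩)]
    · filter_upwards [ae_restrict_mem measurableSet_Ioc] with s hs
      simp [indicator_of_mem hs]
  set α : ℝ → ℝ := fun t => ∫ s in (0 : ℝ)..t, ‖a s‖
  have hα0 : ∀ t, 0 ≤ t → 0 ≤ α t := fun t ht =>
    intervalIntegral.integral_nonneg ht fun s _ => norm_nonneg _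
  have hαT : ∀ t ∈ Icc 0 T, α t ≤ α T := fun t ht =>
    intervalIntegral.integral_mono_interval le_rfl ht.1 ht.2 (.of_forall fun s => norm_nonneg _)
      hint.norm.intervalIntegrable
  let c : ℕ → ℝ := fun m => ‖(1 : 𝔸)‖ * (α T ^ m / m.factorial)
  have hc : Summable c := (Real.summable_pow_div_factorial (α T)).mul_left _
  have hb : ∀ m, ∀ t ∈ Icc 0 T, ‖dyson a m t‖ ≤ c m := fun m t ht => by
    refine (norm_dyson_le hint m ht.1).trans ?_
    have := hα0 t ht.1
    have := hαT t ht
    simp only [c]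
    gcongr
  let Y : ℝ → 𝔸 := fun t => ∑' m, dyson a m t
  have hYs : ∀ t ∈ Icc 0 T, HasSum (fun m => dyson a m t) (Y t) := fun t ht =>
    (Summable.of_norm_bounded hc fun m => hb m t ht).hasSum
  have hYc : ContinuousOn Y (Icc 0 T) :=
    continuousOn_tsum (fun m => (continuous_dyson hint m).continuousOn) hc hb
  refine ⟨Y, fun t ht => ?_, ?_⟩
  · have h1 : HasSum (fun m => ∫ s in (0 : ℝ)..t, a s * dyson a m s)
        (∫ s in (0 : ℝ)..t, a s * Y s) := by
      have hmem : ∀ s ∈ uIoc 0 t, s ∈ Icc 0 T := fun s hs => by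
        rw [uIoc_of_le ht.1] at hs
        exact ⟨hs.1.le, hs.2.trans ht.2⟩
      refine intervalIntegral.hasSum_integral_of_dominated_convergence
        (fun m s => ‖a s‖ * c m) (fun m => ?_) (fun m => .of_forall fun s hs => ?_)
        (.of_forall fun s _ => hc.mul_left _) ?_ (.of_forall fun s hs => ?_)
      · exact hint.1.restrict.mul (continuous_dyson hint m).aestronglyMeasurable
      · exact (norm_mul_le _ _).trans (by gcongr; exact hb m s (hmem s hs))
      · simp only [tsum_mul_left]
        exact (hint.norm.intervalIntegrable).mul_const _
      · exact (hYs s (hmem s hs)).mul_left _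
    -- The integrated series is the Dyson series without its zeroth term, which is `1`.
    have h2 := (hasSum_nat_add_iff' 1).2 (hYs t ht)
    have h3 := h1.unique h2
    rw [h3]
    simp [dyson]
  · have h4 : ContinuousOn Y (uIcc 0 T) := by rwa [uIcc_of_le hT.le]
    have h5 := (hint.intervalIntegrable (a := 0) (b := T)).mul_continuousOn h4
    rwa [intervalIntegrable_iff_integrableOn_Ioc_of_le hT.le] at h5

end Volterra

lemma integrable_sum_sum_smul {E : Type*} [NormedAddCommGroup E] [NormedSpace ℂ E]
    {μ : Measure ℝ} {A : ℝ → Matrix (Fin n) (Fin n) ℂ}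
    (hA : ∀ i j, Integrable (fun t => A t i j) μ) (b : Fin n → Fin n → E) :
    Integrable (fun t => ∑ i, ∑ j, A t i j • b i j) μ :=
  integrable_finsetSum _ fun i _ => integrable_finsetSum _ fun j _ => (hA i j).smul_const _

/-- The Dyson series is summed in the Banach algebra of endomorphisms of `ℂⁿ` and read off
entrywise. `Φ` is defined as a primitive at all times, so absolute continuity is immediate; it
agrees with the series on the period. -/
lemma exists_matrix_flow {T : ℝ} (hT : 0 < T) {A : ℝ → Matrix (Fin n) (Fin n) ℂ}
    (hA : ∀ i j, Integrable (fun t => A t i j) (volume.restrict (Ioc 0 T))) :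
    ∃ Φ, MatACDeriv T Φ (fun t => A t * Φ t) ∧ Φ 0 = 1 := by
  let e : Matrix (Fin n) (Fin n) ℂ ≃ₐ[ℂ] ((Fin n → ℂ) →L[ℂ] (Fin n → ℂ)) :=
    Matrix.toLinAlgEquiv'.trans (Module.End.toContinuousLinearMap _)
  have he : ∀ M v, e M v = M *ᵥ v := fun M v => rfl
  have hA' : Integrable (fun t => e (A t)) (volume.restrict (Ioc 0 T)) := by
    have h2 := integrable_sum_sum_smul hA fun i j => e (Matrix.single i j 1)
    refine h2.congr (.of_forall fun t => ?_)
    dsimp only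
    conv_rhs => rw [matrix_eq_sum_single (A t)]
    simp only [map_sum, ← map_smul, Matrix.smul_single, smul_eq_mul, mul_one]
  obtain ⟨Y, hY, hYi⟩ := exists_volterra_solution hT hA'
  let ent : Fin n → Fin n → ((Fin n → ℂ) →L[ℂ] (Fin n → ℂ)) →L[ℝ] ℂ := fun i j =>
    ((ContinuousLinearMap.proj i : (Fin n → ℂ) →L[ℂ] ℂ).comp
      (ContinuousLinearMap.apply ℂ (Fin n → ℂ) (Pi.single j 1))).restrictScalars ℝ
  have hent : ∀ i j M, ent i j (e M) = M i j := fun i j M => by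
    change (e M (Pi.single j 1)) i = M i j
    simp [he]
  have hent' : ∀ i j s, ent i j (e (A s) * Y s) = (A s * e.symm (Y s)) i j := fun i j s => by
    rw [← hent i j (A s * e.symm (Y s)), map_mul e, AlgEquiv.apply_symm_apply]
  have hi : ∀ i j, Integrable (fun s => (A s * e.symm (Y s)) i j) (volume.restrict (Ioc 0 T)) :=
    fun i j => by simpa only [hent'] using (ent i j).integrable_comp hYi
  let Φ : ℝ → Matrix (Fin n) (Fin n) ℂ := fun t => of fun i j =>
    (1 : Matrix (Fin n) (Fin n) ℂ) i j + ∫ s in (0 : ℝ)..t, (A s * e.symm (Y s)) i j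
  have hΦY : ∀ t ∈ Icc 0 T, Φ t = e.symm (Y t) := fun t ht => by
    ext i j
    have hI : IntervalIntegrable (fun s => e (A s) * Y s) volume 0 t := by
      rw [intervalIntegrable_iff_integrableOn_Ioc_of_le ht.1]
      exact IntegrableOn.mono_set (t := Ioc 0 T) hYi (Ioc_subset_Ioc_right ht.2)
    have h := (ent i j).intervalIntegral_comp_comm hI
    simp only [hent'] at h
    rw [← hent i j (e.symm (Y t)), AlgEquiv.apply_symm_apply, hY t ht, map_add, ← h, ← map_one e, hent]
    rfl
  refine ⟨Φ, fun i j => ?_, by ext i j; simp [Φ]⟩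
  refine (HasACDeriv.of_integrable hT _ (hi i j)).congr_deriv ?_
  filter_upwards [ae_restrict_mem measurableSet_Ioc] with t ht
  rw [hΦY t (Ioc_subset_Icc_self ht)]

/-- The fundamental matrix of `x' = A x` on `[0, T]` together with its inverse. -/
lemma exists_fundamental_matrix {T : ℝ} (hT : 0 < T) {A : ℝ → Matrix (Fin n) (Fin n) ℂ}
    (hA : ∀ i j, Integrable (fun t => A t i j) (volume.restrict (Ioc 0 T))) :
    ∃ Φ Ψ : ℝ → Matrix (Fin n) (Fin n) ℂ, MatACDeriv T Φ (fun t => A t * Φ t) ∧ Φ 0 = 1 ∧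
      ∀ t ∈ Icc 0 T, Ψ t * Φ t = 1 := by
  obtain ⟨Φ, hΦ, hΦ0⟩ := exists_matrix_flow hT hA
  -- The transposed flow of `-Aᵀ` is the inverse of `Φ`: their product has zero derivative and
  -- starts at `1`.
  obtain ⟨Θ, hΘ, hΘ0⟩ := exists_matrix_flow hT (A := fun t => -(A t)ᵀ)
    fun i j => (hA j i).neg
  have hΨ : MatACDeriv T (fun t => (Θ t)ᵀ) fun t => -((Θ t)ᵀ * A t) := fun i j => by
    have h := hΘ j i
    have e : ∀ t, (-((Θ t)ᵀ * A t)) i j = (-(A t)ᵀ * Θ t) j i := fun t => by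
      rw [Matrix.neg_mul, Matrix.neg_apply, Matrix.neg_apply, ← Matrix.transpose_apply (_ * _) i j,
        Matrix.transpose_mul, Matrix.transpose_transpose]
    simpa only [e] using! h
  refine ⟨Φ, fun t => (Θ t)ᵀ, hΦ, hΦ0, fun t ht => ?_⟩
  have h0 : MatACDeriv T (fun t => (Θ t)ᵀ * Φ t) fun _ => 0 :=
    (hΨ.mul hT hΦ).congr_deriv (.of_forall fun t => by simp [Matrix.mul_assoc])
  rw [h0.eq_of_deriv_zero hT ht, hΘ0, hΦ0]
  simp

/-! ### Logarithms of invertible matrices. -/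

lemma algHom_map_exp {𝔸 𝔹 : Type*} [NormedRing 𝔸] [NormedAlgebra ℂ 𝔸] [CompleteSpace 𝔸]
    [Ring 𝔹] [Algebra ℂ 𝔹] [TopologicalSpace 𝔹] [IsTopologicalRing 𝔹] [T2Space 𝔹]
    (f : 𝔸 →ₐ[ℂ] 𝔹) (hf : Continuous f) (x : 𝔸) : f (exp x) = exp (f x) := by
  have h := (exp_series_hasSum_exp' (𝕂 := ℂ) x).map f hf
  rw [exp_eq_tsum ℂ (𝔸 := 𝔹), ← h.tsum_eq]
  simp

/-- In a commutative Banach algebra, a unit has a logarithm if the complex line through it and `1`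
contains only countably many singular elements. -/
lemma exists_exp_eq_of_commute {𝔸 : Type*} [NormedRing 𝔸] [NormedAlgebra ℂ 𝔸] [CompleteSpace 𝔸]
    (hc : ∀ x y : 𝔸, Commute x y) (u : 𝔸ˣ)
    (hs : {z : ℂ | ¬ IsUnit (1 + z • ((u : 𝔸) - 1))}.Countable) : ∃ x : 𝔸, exp x = u := by
  let : NormedAlgebra ℚ 𝔸 := .restrictScalars ℚ ℂ 𝔸
  let E : Subgroup 𝔸ˣ :=
    { carrier := {v | ∃ x : 𝔸, exp x = v}
      mul_mem' := by
        rintro v w ⟨x, hx⟩ ⟨y, hy⟩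
        exact ⟨x + y, by rw [exp_add_of_commute (hc x y), hx, hy, Units.val_mul]⟩
      one_mem' := ⟨0, by simp⟩
      inv_mem' := by
        rintro v ⟨x, hx⟩
        refine ⟨-x, ?_⟩
        have h : exp (-x) * exp x = 1 := by
          rw [← exp_add_of_commute (hc _ _)]
          simp
        rw [hx] at h
        exact (Units.eq_inv_of_mul_eq_one_right h) }
  -- The exponential has invertible derivative at `0`, so its range contains a neighbourhood of `1`;
  -- a subgroup with this property is open and closed.
  have hE1 : (E : Set 𝔸ˣ) ∈ nhds (1 : 𝔸ˣ) := by
    have h1 : map (exp : 𝔸 → 𝔸) (nhds 0) = nhds (exp 0) :=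
      HasStrictFDerivAt.map_nhds_eq_of_equiv (f' := ContinuousLinearEquiv.refl ℂ 𝔸)
        (hasStrictFDerivAt_exp_zero (𝕂 := ℂ))
    have h2 : range (exp : 𝔸 → 𝔸) ∈ nhds (1 : 𝔸) := by
      rw [← exp_zero (𝔸 := 𝔸), ← h1]
      exact range_mem_map
    exact Units.continuous_val.tendsto (1 : 𝔸ˣ) h2
  have hEo : IsOpen (E : Set 𝔸ˣ) := E.isOpen_of_mem_nhds hE1
  have hEc : IsClosed (E : Set 𝔸ˣ) := E.isClosed_of_isOpen hEo
  set s := {z : ℂ | ¬ IsUnit (1 + z • ((u : 𝔸) - 1))}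
  -- Removing countably many points from `ℂ` leaves a connected set, so the units `1 + z (u - 1)`
  -- connect `1` at `z = 0` to `u` at `z = 1` and stay in `E`.
  have hpc : IsPathConnected sᶜ := hs.isPathConnected_compl_of_one_lt_rank (by simp)
  have : PreconnectedSpace ↥sᶜ :=
    isPreconnected_iff_preconnectedSpace.1 hpc.isConnected.isPreconnected
  have hu : ∀ z : ↥sᶜ, IsUnit (1 + (z : ℂ) • ((u : 𝔸) - 1)) := fun z => not_not.1 z.2
  let γ : ↥sᶜ → 𝔸ˣ := fun z => (hu z).unit
  have hγ : Continuous γ := by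
    rw [Units.isOpenEmbedding_val.isInducing.continuous_iff]
    change Continuous fun z : ↥sᶜ => 1 + (z : ℂ) • ((u : 𝔸) - 1)
    fun_prop
  have h0 : (0 : ℂ) ∈ sᶜ := by simp [s]
  have h1 : (1 : ℂ) ∈ sᶜ := by simp [s]
  have hcl : IsClopen (γ ⁻¹' (E : Set 𝔸ˣ)) := ⟨hEc.preimage hγ, hEo.preimage hγ⟩
  have huniv := hcl.eq_univ ⟨⟨0, h0⟩, ⟨0, by simp [γ]⟩⟩
  have hm : (⟨1, h1⟩ : ↥sᶜ) ∈ γ ⁻¹' (E : Set 𝔸ˣ) := huniv ▸ mem_univ _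
  obtain ⟨x, hx⟩ := hm
  exact ⟨x, by rw [hx]; simp [γ]⟩

/-- An invertible endomorphism with countable spectrum has a logarithm. -/
lemma exists_exp_eq_of_countable_spectrum {𝔸 : Type*} [NormedRing 𝔸] [NormedAlgebra ℂ 𝔸]
    [CompleteSpace 𝔸] (u : 𝔸ˣ)
    (hs : (spectrum ℂ ((u : 𝔸) - 1)).Countable) : ∃ x : 𝔸, exp x = u := by
  -- The bicommutant of `u` is closed, commutative and stable under inverses, so the commutative
  -- case applies inside it.
  let S : Subalgebra ℂ 𝔸 := Subalgebra.centralizer ℂ (Set.centralizer {(u : 𝔸)})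
  have hS : ∀ x : 𝔸, x ∈ S ↔ ∀ y : 𝔸, y * u = u * y → y * x = x * y := fun x => by
    simp [S, Subalgebra.mem_centralizer_iff, Set.mem_centralizer_iff, eq_comm]
  have huS : (u : 𝔸) ∈ S := (hS _).2 fun y hy => hy
  have hcl : IsClosed (S : Set 𝔸) := by
    change IsClosed (Set.centralizer (Set.centralizer {(u : 𝔸)}))
    exact Set.isClosed_centralizer _
  have : CompleteSpace S := hcl.completeSpace_coe
  have hc : ∀ x y : S, Commute x y := fun x y => Subtype.ext <|
    (hS y).1 y.2 x (((hS x).1 x.2 u rfl).symm)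
  have hinv : ∀ x : S, IsUnit (x : 𝔸) → IsUnit x := by
    rintro x ⟨v, hv⟩
    have hm : ((v⁻¹ : 𝔸ˣ) : 𝔸) ∈ S := (hS _).2 fun y hy => by
      have h : y * (v : 𝔸) = v * y := by
        rw [hv]
        exact (hS x).1 x.2 y hy
      exact (Commute.units_inv_right (show Commute y (v : 𝔸) from h)).eq
    refine ⟨⟨x, ⟨_, hm⟩, Subtype.ext ?_, Subtype.ext ?_⟩, rfl⟩
    · simp [← hv]
    · simp [← hv]
  obtain ⟨w, hw⟩ := hinv ⟨u, huS⟩ u.isUnit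
  obtain ⟨x, hx⟩ := exists_exp_eq_of_commute hc w (by
    have hsub : {z : ℂ | ¬ IsUnit (1 + z • ((w : S) - 1))} ⊆
        (fun z => -z⁻¹) '' spectrum ℂ ((u : 𝔸) - 1) := by
      intro z hz
      have hz0 : z ≠ 0 := by
        rintro rfl
        simp at hz
      refine ⟨-z⁻¹, fun hunit => hz (hinv _ ?_), by simp⟩
      -- For `z ≠ 0`, `1 + z (u - 1)` is a nonzero multiple of `-z⁻¹ - (u - 1)`, so it is singular
      -- only if `-z⁻¹` lies in the spectrum of `u - 1`.
      have e : (((1 + z • ((w : S) - 1) : S)) : 𝔸) =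
          (Units.mk0 (-z) (neg_ne_zero.2 hz0)) • (algebraMap ℂ 𝔸 (-z⁻¹) - ((u : 𝔸) - 1)) := by
        rw [hw, Units.smul_def, Units.val_mk0, smul_sub (-z) (algebraMap ℂ 𝔸 (-z⁻¹)),
          Algebra.algebraMap_eq_smul_one, smul_smul]
        simp [hz0]
      rw [e]
      exact (isUnit_smul_iff _ _).2 hunit
    exact (hs.image _).mono hsub)
  refine ⟨x, ?_⟩
  have h := algHom_map_exp S.val continuous_subtype_val x
  rw [hx, hw] at h
  exact h.symm

/-- Invertible complex matrices have a logarithm. -/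
lemma exists_matrix_exp_eq {M N : Matrix (Fin n) (Fin n) ℂ} (hNM : N * M = 1) :
    ∃ R : Matrix (Fin n) (Fin n) ℂ, exp R = M := by
  let e : Matrix (Fin n) (Fin n) ℂ ≃ₐ[ℂ] ((Fin n → ℂ) →L[ℂ] (Fin n → ℂ)) :=
    Matrix.toLinAlgEquiv'.trans (Module.End.toContinuousLinearMap _)
  let u : ((Fin n → ℂ) →L[ℂ] (Fin n → ℂ))ˣ := ⟨e M, e N,
    by rw [← map_mul, mul_eq_one_comm.1 hNM, map_one], by rw [← map_mul, hNM, map_one]⟩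
  obtain ⟨x, hx⟩ := exists_exp_eq_of_countable_spectrum u (by
    have h : ((u : (Fin n → ℂ) →L[ℂ] (Fin n → ℂ)) - 1) = e (M - 1) := by
      rw [map_sub, map_one]
    rw [h, AlgEquiv.spectrum_eq]
    exact (Matrix.finite_spectrum _).countable)
  have hcont : Continuous e.symm := e.symm.toLinearMap.continuous_of_finiteDimensional
  have h := algHom_map_exp e.symm.toAlgHom hcont x
  refine ⟨e.symm x, ?_⟩
  exact h.symm.trans ((congrArg e.symm hx).trans (e.symm_apply_apply M))

/-! ### Discrete Lyapunov stability and decay along the flow. -/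

lemma re_quadratic_smul (H : Matrix (Fin n) (Fin n) ℂ) (c : ℝ) (v : Fin n → ℂ) :
    (star ((c : ℂ) • v) ⬝ᵥ (H *ᵥ ((c : ℂ) • v))).re = c ^ 2 * (star v ⬝ᵥ (H *ᵥ v)).re := by
  rw [star_smul, mulVec_smul, smul_dotProduct, dotProduct_smul, smul_smul, smul_eq_mul]
  have : star (c : ℂ) * (c : ℂ) = ((c ^ 2 : ℝ) : ℂ) := by
    simp [pow_two]
  rw [this, Complex.re_ofReal_mul]

lemma continuous_re_quadratic (H : Matrix (Fin n) (Fin n) ℂ) :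
    Continuous fun v : Fin n → ℂ => (star v ⬝ᵥ (H *ᵥ v)).re := by
  refine Complex.continuous_re.comp (Continuous.dotProduct continuous_star ?_)
  exact Continuous.matrix_mulVec continuous_const continuous_id

/-- A discrete Lyapunov inequality forces the powers to tend to zero. -/
lemma tendsto_pow_mulVec_zero {H M : Matrix (Fin n) (Fin n) ℂ}
    (hnn : ∀ v : Fin n → ℂ, 0 ≤ (star v ⬝ᵥ (H *ᵥ v)).re)
    (hdec : ∀ v : Fin n → ℂ, v ≠ 0 →
      (star (M *ᵥ v) ⬝ᵥ (H *ᵥ (M *ᵥ v))).re < (star v ⬝ᵥ (H *ᵥ v)).re) (v : Fin n → ℂ) :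
    Tendsto (fun k : ℕ => (M ^ k) *ᵥ v) atTop (nhds 0) := by
  let q : (Fin n → ℂ) → ℝ := fun v => (star v ⬝ᵥ (H *ᵥ v)).re
  have hq : Continuous q := continuous_re_quadratic H
  -- Compactness of the unit sphere and homogeneity make the decrease uniform; for `n = 0` the
  -- sphere is empty and any `δ` works.
  have hδ : ∃ δ > 0, ∀ v, δ * ‖v‖ ^ 2 ≤ q v - q (M *ᵥ v) := by
    rcases isEmpty_or_nonempty (Fin n) with hn | hn
    · exact ⟨1, one_pos, fun v => by
        rw [Subsingleton.elim (M *ᵥ v) v, Subsingleton.elim v 0]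
        simp⟩
    · have hcont : Continuous fun v => q v - q (M *ᵥ v) :=
        hq.sub (hq.comp (Continuous.matrix_mulVec continuous_const continuous_id))
      have hne : (Metric.sphere (0 : Fin n → ℂ) 1).Nonempty :=
        NormedSpace.sphere_nonempty.2 zero_le_one
      obtain ⟨w, hw, hmin⟩ := (isCompact_sphere (0 : Fin n → ℂ) 1).exists_isMinOn hne
        hcont.continuousOn
      have hw0 : w ≠ 0 := by
        rintro rfl
        simp at hw
      refine ⟨q w - q (M *ᵥ w), sub_pos.2 (hdec w hw0), fun v => ?_⟩
      rcases eq_or_ne v 0 with rfl | hv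
      · simp [q]
      · have hv' : ‖v‖ ≠ 0 := norm_ne_zero_iff.2 hv
        set u : Fin n → ℂ := ((‖v‖⁻¹ : ℝ) : ℂ) • v
        have hu : u ∈ Metric.sphere (0 : Fin n → ℂ) 1 := by
          simp [u, norm_smul, hv']
        have hvu : v = ((‖v‖ : ℝ) : ℂ) • u := by
          simp only [u, smul_smul]
          rw [← Complex.ofReal_mul, mul_inv_cancel₀ hv', Complex.ofReal_one, one_smul]
        have h1 : q v = ‖v‖ ^ 2 * q u := by
          conv_lhs => rw [hvu]
          exact re_quadratic_smul H _ u
        have h2 : q (M *ᵥ v) = ‖v‖ ^ 2 * q (M *ᵥ u) := by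
          conv_lhs => rw [hvu, mulVec_smul]
          exact re_quadratic_smul H _ _
        have h3 : q w - q (M *ᵥ w) ≤ q u - q (M *ᵥ u) := hmin hu
        rw [h1, h2]
        nlinarith [sq_nonneg ‖v‖]
  obtain ⟨δ, hδ0, hδ⟩ := hδ
  let s : ℕ → ℝ := fun k => q ((M ^ k) *ᵥ v)
  have hstep : ∀ k, δ * ‖(M ^ k) *ᵥ v‖ ^ 2 ≤ s k - s (k + 1) := fun k => by
    have := hδ ((M ^ k) *ᵥ v)
    rwa [mulVec_mulVec, ← pow_succ'] at this
  -- The form decreases along the orbit and is bounded below, so its increments tend to zero and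
  -- control `‖M^k v‖²`.
  have hanti : Antitone s := antitone_nat_of_succ_le fun k => by
    have h1 : 0 ≤ δ * ‖(M ^ k) *ᵥ v‖ ^ 2 := by positivity
    linarith [hstep k]
  have hlim := tendsto_atTop_ciInf hanti ⟨0, by rintro _ ⟨k, rfl⟩; exact hnn _⟩
  have hdiff : Tendsto (fun k => s k - s (k + 1)) atTop (nhds 0) := by
    simpa using hlim.sub ((tendsto_add_atTop_iff_nat 1).2 hlim)
  have h4 : Tendsto (fun k => δ * ‖(M ^ k) *ᵥ v‖ ^ 2) atTop (nhds 0) :=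
    squeeze_zero (fun k => by positivity) hstep hdiff
  have h5 : Tendsto (fun k => ‖(M ^ k) *ᵥ v‖ ^ 2) atTop (nhds 0) := by
    simpa [hδ0.ne'] using h4.const_mul δ⁻¹
  have h6 := h5.sqrt
  simp only [Real.sqrt_zero, Real.sqrt_sq (norm_nonneg _)] at h6
  exact tendsto_zero_iff_norm_tendsto_zero.2 h6

/-- Iterating gives `v^* B w = (M^k v)^* B (M^k w)`, which tends to zero. No symmetry of `B` is
needed. -/
lemma eq_zero_of_conjTranspose_mul_mul_eq {M B : Matrix (Fin n) (Fin n) ℂ}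
    (hM : ∀ v : Fin n → ℂ, Tendsto (fun k : ℕ => (M ^ k) *ᵥ v) atTop (nhds 0))
    (hB : Mᴴ * B * M = B) : B = 0 := by
  have hk : ∀ k : ℕ, (M ^ k)ᴴ * B * M ^ k = B := by
    intro k
    induction k with
    | zero => simp
    | succ k ih =>
      calc (M ^ (k + 1))ᴴ * B * M ^ (k + 1) = Mᴴ * ((M ^ k)ᴴ * B * M ^ k) * M := by
            simp [pow_succ, Matrix.conjTranspose_mul, Matrix.mul_assoc]
        _ = B := by rw [ih, hB]
  have hform : ∀ v w : Fin n → ℂ, star v ⬝ᵥ (B *ᵥ w) = 0 := by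
    intro v w
    have h1 : ∀ k : ℕ, star v ⬝ᵥ (B *ᵥ w) = star ((M ^ k) *ᵥ v) ⬝ᵥ (B *ᵥ ((M ^ k) *ᵥ w)) := by
      intro k
      conv_lhs => rw [← hk k]
      rw [star_mulVec, ← mulVec_mulVec, ← mulVec_mulVec, dotProduct_mulVec]
    have h2 : Continuous fun z : (Fin n → ℂ) × (Fin n → ℂ) => star z.1 ⬝ᵥ (B *ᵥ z.2) :=
      Continuous.dotProduct (continuous_star.comp continuous_fst)
        (Continuous.matrix_mulVec continuous_const continuous_snd)
    have h3 := (h2.tendsto (0, 0)).comp ((hM v).prodMk_nhds (hM w))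
    simp only [Function.comp_def, ← h1] at h3
    simpa using tendsto_nhds_unique tendsto_const_nhds h3
  ext i j
  simpa [← Pi.single_star] using hform (Pi.single i 1) (Pi.single j 1)

lemma MatACDeriv.quadratic {T : ℝ} {F F' : ℝ → Matrix (Fin n) (Fin n) ℂ} (hT : 0 < T)
    (hF : MatACDeriv T F F') (v w : Fin n → ℂ) :
    HasACDeriv T (fun t => v ⬝ᵥ (F t *ᵥ w)) fun t => v ⬝ᵥ (F' t *ᵥ w) := by
  have h : HasACDeriv T (fun t => ∑ i, ∑ j, v i * w j * F t i j)
      (fun t => ∑ i, ∑ j, v i * w j * F' t i j) :=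
    HasACDeriv.sum _ fun i _ => HasACDeriv.sum _ fun j _ => by
      simpa using (HasACDeriv.const (v i * w j)).mul hT (hF i j)
  convert h using 2 <;>
  · simp only [dotProduct, mulVec, Finset.mul_sum]
    exact Finset.sum_congr rfl fun i _ => Finset.sum_congr rfl fun j _ => by ring

/-- The Lyapunov equation along the flow of `x' = A x`. -/
lemma MatACDeriv.lyapunov_flow {T : ℝ} (hT : 0 < T) {A Q P Φ : ℝ → Matrix (Fin n) (Fin n) ℂ}
    (hP : MatACDeriv T P fun t => -((A t)ᴴ * P t + P t * A t + Q t))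
    (hΦ : MatACDeriv T Φ fun t => A t * Φ t) :
    MatACDeriv T (fun t => (Φ t)ᴴ * P t * Φ t) fun t => -((Φ t)ᴴ * Q t * Φ t) := by
  refine ((hΦ.conjTranspose.mul hT hP).mul hT hΦ).congr_deriv (.of_forall fun t => ?_)
  simp only [Matrix.conjTranspose_mul, Matrix.mul_add, Matrix.add_mul, Matrix.mul_neg,
    Matrix.neg_mul, Matrix.mul_assoc]
  abel

/-- Along `x = Φ v` the derivative of `x^* P x` is `-x^* Q x`, negative almost everywhere since `Φ`
is invertible. Positivity of `P` plays no role, so the decay can later be used to prove it. -/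
lemma re_quadratic_flow_lt {T : ℝ} (hT : 0 < T) {A Q P Φ Ψ : ℝ → Matrix (Fin n) (Fin n) ℂ}
    (hP : MatACDeriv T P fun t => -((A t)ᴴ * P t + P t * A t + Q t))
    (hΦ : MatACDeriv T Φ fun t => A t * Φ t) (hΨ : ∀ t ∈ Icc 0 T, Ψ t * Φ t = 1)
    (hQ : ∀ᵐ t ∂volume.restrict (Ioc 0 T), (Q t).PosDef) {a b : ℝ} (ha : 0 ≤ a) (hab : a < b)
    (hb : b ≤ T) {v : Fin n → ℂ} (hv : v ≠ 0) :
    (star (Φ b *ᵥ v) ⬝ᵥ (P b *ᵥ (Φ b *ᵥ v))).re <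
      (star (Φ a *ᵥ v) ⬝ᵥ (P a *ᵥ (Φ a *ᵥ v))).re := by
  have e : ∀ (F S : Matrix (Fin n) (Fin n) ℂ), star v ⬝ᵥ ((Fᴴ * S * F) *ᵥ v) =
      star (F *ᵥ v) ⬝ᵥ (S *ᵥ (F *ᵥ v)) := fun F S => by
    rw [star_mulVec, ← mulVec_mulVec, ← mulVec_mulVec, dotProduct_mulVec]
  have hI := (MatACDeriv.lyapunov_flow hT hP hΦ).quadratic hT (star v) v
  have h1 := hI.integral_eq hT (a := a) (b := b) ⟨ha, hab.le.trans hb⟩ ⟨ha.trans hab.le, hb⟩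
  rw [e, e] at h1
  have hsub : Ioc a b ⊆ Ioc 0 T := Ioc_subset_Ioc ha hb
  have hint : Integrable (fun t => star v ⬝ᵥ ((-((Φ t)ᴴ * Q t * Φ t)) *ᵥ v))
      (volume.restrict (Ioc a b)) := IntegrableOn.mono_set (t := Ioc 0 T) hI.int hsub
  have hpos : ∀ᵐ t ∂volume.restrict (Ioc a b),
      (star v ⬝ᵥ ((-((Φ t)ᴴ * Q t * Φ t)) *ᵥ v)).re < 0 := by
    filter_upwards [ae_restrict_of_ae_restrict_of_subset hsub hQ,
      ae_restrict_mem measurableSet_Ioc] with t ht hm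
    have hne : Φ t *ᵥ v ≠ 0 := fun h => hv (by
      have := hΨ t (Ioc_subset_Icc_self (hsub hm))
      rw [← one_mulVec v, ← this, ← mulVec_mulVec, h, mulVec_zero])
    have h2 := (Complex.lt_def.1 (ht.dotProduct_mulVec_pos hne)).1
    rw [neg_mulVec, dotProduct_neg, e, Complex.neg_re]
    simpa using h2
  have h3 : ∫ t in Ioc a b, (star v ⬝ᵥ ((-((Φ t)ᴴ * Q t * Φ t)) *ᵥ v)).re < 0 := by
    have hint' : Integrable (fun t => -(star v ⬝ᵥ ((-((Φ t)ᴴ * Q t * Φ t)) *ᵥ v)).re)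
      (volume.restrict (Ioc a b)) := hint.re.neg
    have hnn : 0 ≤ᵐ[volume.restrict (Ioc a b)]
        fun t => -(star v ⬝ᵥ ((-((Φ t)ᴴ * Q t * Φ t)) *ᵥ v)).re := by
      filter_upwards [hpos] with t ht using (neg_pos.2 ht).le
    have h4 := integral_nonneg_of_ae hnn
    rw [integral_neg] at h4
    refine lt_of_le_of_ne (by linarith) fun h0 => ?_
    -- A zero integral would make the negative integrand vanish almost everywhere on an interval of
    -- positive length.
    have h5 := (integral_eq_zero_iff_of_nonneg_ae hnn hint').1 (by rw [integral_neg, h0, neg_zero])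
    have h6 : ∀ᵐ t ∂volume.restrict (Ioc a b), False := by
      filter_upwards [h5, hpos] with t h7 h8
      simp only [Pi.zero_apply, neg_eq_zero] at h7
      exact h8.ne h7
    rw [ae_restrict_iff' measurableSet_Ioc] at h6
    have h9 : volume (Ioc a b) = 0 := by
      refine measure_mono_null ?_ (ae_iff.1 h6)
      intro t ht
      simpa using ht
    rw [Real.volume_Ioc] at h9
    exact (ENNReal.ofReal_pos.2 (sub_pos.2 hab)).ne' h9
  have h10 := congrArg Complex.re h1
  rw [intervalIntegral.integral_of_le hab.le, Complex.sub_re] at h10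
  have h11 := integral_re hint
  simp only [RCLike.re_to_complex] at h11
  rw [h11] at h3
  linarith

/-! ### Complexification and phasors of real matrix functions. -/

/-- Complexification of a real matrix function. -/
def complexify (F : ℝ → Matrix (Fin n) (Fin n) ℝ) (t : ℝ) : Matrix (Fin n) (Fin n) ℂ :=
  (F t).map Complex.ofReal

lemma complexify_apply (F : ℝ → Matrix (Fin n) (Fin n) ℝ) (t : ℝ) (a b : Fin n) :
    complexify F t a b = (F t a b : ℂ) := rfl

lemma exp_mode_periodic (T : ℝ) (k : ℤ) : Function.Periodic
    (fun τ : ℝ => Complex.exp (-(Complex.I * (2 * Real.pi / T : ℝ) * k * τ))) T := by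
  intro τ
  simp only [← fourier_neg_eq_exp]
  rw [AddCircle.coe_add, AddCircle.coe_period, add_zero]

/-- Over a full window ending at a multiple of the period, the phasors are the Fourier coefficients
of the translated function. -/
lemma phasor_eq_fc_add (T : ℝ) (F : ℝ → Matrix (Fin n) (Fin n) ℝ) (k m : ℤ)
    (a b : Fin n) : phasor T F k (T + m * T) a b =
      fc T (fun t => complexify F (t + m * T) a b) k := by
  unfold phasor fc
  congr 1
  have h := intervalIntegral.integral_comp_add_right (a := 0) (b := T) (fun τ : ℝ =>
    (F τ a b : ℂ) * Complex.exp (-(Complex.I * (2 * Real.pi / T : ℝ) * k * τ))) (m * T)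
  have e : T + m * T - T = 0 + m * T := by ring
  rw [e, ← h]
  refine intervalIntegral.integral_congr fun t _ => ?_
  exact congrArg ((F (t + m * T) a b : ℂ) * ·) ((exp_mode_periodic T k).int_mul m t)

lemma phasor_eq_fc {T : ℝ} {F : ℝ → Matrix (Fin n) (Fin n) ℝ}
    (hF : Function.Periodic F T) (k : ℤ) (t : ℝ) (a b : Fin n) :
    phasor T F k t a b = fc T (fun t => complexify F t a b) k := by
  unfold phasor fc
  congr 1
  have hp : Function.Periodic (fun τ : ℝ => (F τ a b : ℂ) *
      Complex.exp (-(Complex.I * (2 * Real.pi / T : ℝ) * k * τ))) T := fun τ => by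
    have := exp_mode_periodic T k τ
    simp only at this
    simp only [this, hF τ]
  have h := hp.intervalIntegral_add_eq (t - T) 0
  rw [sub_add_cancel, zero_add] at h
  exact h

lemma toeplitz_eq_toep {T : ℝ} {F : ℝ → Matrix (Fin n) (Fin n) ℝ}
    (hF : Function.Periodic F T) (t : ℝ) : toeplitz T F t = toep T (complexify F) := by
  ext p q
  exact phasor_eq_fc hF _ _ _ _

lemma toeplitz_eq_toep_add (T : ℝ) (F : ℝ → Matrix (Fin n) (Fin n) ℝ) (m : ℤ) :
    toeplitz T F (T + m * T) = toep T fun t => complexify F (t + m * T) := by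
  ext p q
  exact phasor_eq_fc_add _ _ _ _ _ _

lemma toeplitz_congr_ae {T : ℝ} {F G : ℝ → Matrix (Fin n) (Fin n) ℝ} (h : F =ᵐ[volume] G)
    (t : ℝ) : toeplitz T F t = toeplitz T G t := by
  ext p q
  unfold toeplitz phasor
  congr 1
  refine intervalIntegral.integral_congr_ae ?_
  filter_upwards [h] with τ hτ _
  rw [hτ]

lemma isHermitian_complexify_iff {Q : Matrix (Fin n) (Fin n) ℝ} :
    (Q.map Complex.ofReal).IsHermitian ↔ Q.IsHermitian := by
  simp only [Matrix.IsHermitian.ext_iff, Matrix.map_apply]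
  simp

/-- The cross terms between real and imaginary parts of `v` are purely imaginary, so symmetry of `Q`
is not needed. -/
lemma re_quadratic_complexify (Q : Matrix (Fin n) (Fin n) ℝ) (v : Fin n → ℂ) :
    (star v ⬝ᵥ (Q.map Complex.ofReal *ᵥ v)).re =
      (fun i => (v i).re) ⬝ᵥ (Q *ᵥ fun i => (v i).re) +
      (fun i => (v i).im) ⬝ᵥ (Q *ᵥ fun i => (v i).im) := by
  simp only [dotProduct, mulVec, Matrix.map_apply, Complex.re_sum, Finset.mul_sum, Pi.star_apply,
    ← Finset.sum_add_distrib]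
  refine Finset.sum_congr rfl fun i _ => Finset.sum_congr rfl fun j _ => ?_
  simp [Complex.mul_re]

lemma posDef_complexify {Q : Matrix (Fin n) (Fin n) ℝ} (hQ : Q.PosDef) :
    (Q.map Complex.ofReal).PosDef := by
  have hH := isHermitian_complexify_iff.2 hQ.1
  refine .of_dotProduct_mulVec_pos hH fun v hv => ?_
  rw [Complex.lt_def]
  refine ⟨?_, (hH.im_star_dotProduct_mulVec_self v).symm⟩
  rw [re_quadratic_complexify]
  have hnn : ∀ w : Fin n → ℝ, 0 ≤ w ⬝ᵥ (Q *ᵥ w) := fun w => by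
    simpa using hQ.posSemidef.dotProduct_mulVec_nonneg w
  have hpos : ∀ w : Fin n → ℝ, w ≠ 0 → 0 < w ⬝ᵥ (Q *ᵥ w) := fun w hw => by
    simpa using hQ.dotProduct_mulVec_pos hw
  by_cases hre : (fun i => (v i).re) = 0
  · have him : (fun i => (v i).im) ≠ 0 := fun him => hv (by
      ext i
      exact Complex.ext (congrFun hre i) (congrFun him i))
    exact add_pos_of_nonneg_of_pos (hnn _) (hpos _ him)
  · exact add_pos_of_pos_of_nonneg (hpos _ hre) (hnn _)

lemma re_quadratic_ofReal (Q : Matrix (Fin n) (Fin n) ℝ) (w : Fin n → ℝ) :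
    (star (fun i => (w i : ℂ)) ⬝ᵥ (Q.map Complex.ofReal *ᵥ fun i => (w i : ℂ))).re =
      w ⬝ᵥ (Q *ᵥ w) := by
  rw [re_quadratic_complexify]
  simp [dotProduct]

/-! ### The harmonic Lyapunov operator on Toeplitz matrices. -/

lemma hasSum_mul_diagN (M : BlockMatrix n) (T : ℝ) (p q : ℤ × Fin n) :
    HasSum (fun r => M p r * diagN n T r q)
      (M p q * (Complex.I * (2 * Real.pi / T : ℝ) * q.1)) := by
  convert! hasSum_single (f := fun r => M p r * diagN n T r q) q ?_ using 1
  · simp [diagN]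
  · intro r hr
    simp [diagN, Matrix.diagonal_apply_ne _ hr]

lemma hasSum_diagN_mul (M : BlockMatrix n) (T : ℝ) (p q : ℤ × Fin n) :
    HasSum (fun r => (diagN n T)ᴴ p r * M r q)
      (-(Complex.I * (2 * Real.pi / T : ℝ) * p.1) * M p q) := by
  convert! hasSum_single (f := fun r => (diagN n T)ᴴ p r * M r q) p ?_ using 1
  · simp [diagN]
  · intro r hr
    simp [diagN, Matrix.diagonal_apply_ne _ hr]

section Entries

variable {T : ℝ} {A P : ℝ → Matrix (Fin n) (Fin n) ℂ}

lemma hasSum_left (hT : 0 < T) (hA : ∀ a b, SqInt T fun t => A t a b)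
    (hP : ∀ a b, SqInt T fun t => P t a b) (p q : ℤ × Fin n) :
    HasSum (fun r => toep T P p r * (toep T A - diagN n T) r q)
      (toep T (fun t => P t * A t) p q -
        toep T P p q * (Complex.I * (2 * Real.pi / T : ℝ) * q.1)) := by
  simpa [mul_sub] using (hasSum_toep_mul hT hP hA p q).sub (hasSum_mul_diagN (toep T P) T p q)

lemma hasSum_right (hT : 0 < T) (hA : ∀ a b, SqInt T fun t => A t a b)
    (hP : ∀ a b, SqInt T fun t => P t a b) (p q : ℤ × Fin n) :
    HasSum (fun r => (toep T A - diagN n T)ᴴ p r * toep T P r q)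
      (toep T (fun t => (A t)ᴴ * P t) p q +
        (Complex.I * (2 * Real.pi / T : ℝ) * p.1) * toep T P p q) := by
  have h := (hasSum_toep_mul hT (F := fun t => (A t)ᴴ) (fun a b => (hA b a).conj) hP p q).sub
    (hasSum_diagN_mul (toep T P) T p q)
  rw [← conjTranspose_toep hT] at h
  simpa only [Matrix.conjTranspose_sub, Matrix.sub_apply, sub_mul, neg_mul, sub_neg_eq_add]
    using h

lemma integrable_matrix_mul_apply {F G : ℝ → Matrix (Fin n) (Fin n) ℂ}
    (hF : ∀ a b, SqInt T fun t => F t a b) (hG : ∀ a b, SqInt T fun t => G t a b) (a b : Fin n) :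
    Integrable (fun t => (F t * G t) a b) (volume.restrict (Ioc 0 T)) := by
  simpa [Matrix.mul_apply] using
    integrable_finsetSum Finset.univ fun c _ => (hF a c).integrable_mul (hG c b)

/-- The harmonic Lyapunov operator applied to a block Toeplitz matrix, entry by entry. -/
lemma lyapunov_entry (hT : 0 < T) (hA : ∀ a b, SqInt T fun t => A t a b)
    (hP : ∀ a b, SqInt T fun t => P t a b) {Q : ℝ → Matrix (Fin n) (Fin n) ℂ}
    (hQ : ∀ a b, SqInt T fun t => Q t a b) (p q : ℤ × Fin n) :
    (infMul (toep T P) (toep T A - diagN n T) + infMul (toep T A - diagN n T)ᴴ (toep T P) +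
      toep T Q) p q =
    fc T (fun t => ((A t)ᴴ * P t + P t * A t + Q t) p.2 q.2) (p.1 - q.1) +
      Complex.I * (2 * Real.pi / T : ℝ) * (p.1 - q.1 : ℤ) *
        fc T (fun t => P t p.2 q.2) (p.1 - q.1) := by
  have h1 := integrable_matrix_mul_apply (F := fun t => (A t)ᴴ) (fun a b => (hA b a).conj) hP p.2 q.2
  have h2 := integrable_matrix_mul_apply hP hA p.2 q.2
  simp only [Matrix.add_apply]
  have h3 : Integrable (fun t => ((A t)ᴴ * P t) p.2 q.2 + (P t * A t) p.2 q.2)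
    (volume.restrict (Ioc 0 T)) := h1.add h2
  rw [fc_add hT h3 (hQ p.2 q.2).integrable, fc_add hT h1 h2]
  simp only [infMul, (hasSum_left hT hA hP p q).tsum_eq, (hasSum_right hT hA hP p q).tsum_eq]
  simp only [toep]
  push_cast
  ring

/-- A periodic solution of the Lyapunov differential equation yields a solution of the harmonic
Lyapunov equation. -/
lemma isHarmonicLyapunovSolution_toep (hT : 0 < T) (hA : ∀ a b, SqInt T fun t => A t a b)
    {Q : ℝ → Matrix (Fin n) (Fin n) ℂ} (hQ : ∀ a b, SqInt T fun t => Q t a b)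
    (hP : MatACDeriv T P fun t => -((A t)ᴴ * P t + P t * A t + Q t)) (hP0 : P 0 = P T)
    (hpos : ∀ t, (P t).PosDef) :
    IsHarmonicLyapunovSolution T (toep T A) (toep T Q) (toep T P) := by
  have htop : ∀ a b, MemLp (fun t => P t a b) ⊤ (volume.restrict (Ioc 0 T)) :=
    fun a b => (hP a b).memLp_top hT
  have hsq : ∀ a b, SqInt T fun t => P t a b := fun a b => sqInt_of_top (htop a b)
  refine ⟨?_, fun X _ _ => ?_, isPositiveDefinite_toep hT htop (.of_forall hpos),
    fun p q => (hasSum_left hT hA hsq p q).summable,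
    fun p q => (hasSum_right hT hA hsq p q).summable, ?_⟩
  · rw [Matrix.IsHermitian, conjTranspose_toep hT]
    simp only [(hpos _).1.eq]
  · obtain ⟨x, hx⟩ := exists_function_represents hT X
    obtain ⟨Z, hZ, -⟩ := exists_actsTo_toep hT htop hx
    exact ⟨Z, hZ⟩
  · ext p q
    rw [lyapunov_entry hT hA hsq hQ]
    -- The commutator with `N` supplies exactly the coefficient of the derivative, so the entry is a
    -- coefficient of the differential equation.
    have h := (hP p.2 q.2).fc_deriv hT (by rw [hP0]) (p.1 - q.1)
    simp only [Matrix.neg_apply, fc_neg] at h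
    rw [← h, add_neg_cancel]
    rfl

end Entries

/-! ### The domain of `N` as the range of `(1 + N)⁻¹`, and operators defined on it. -/

lemma memlp_of_norm_le {ι : Type*} {f g : ι → ℂ} (hg : Memℓp g 2) (h : ∀ i, ‖f i‖ ≤ ‖g i‖) :
    Memℓp f 2 := by
  have h2 : (0 : ℝ) < (2 : ENNReal).toReal := by norm_num
  rw [memℓp_gen_iff h2] at hg ⊢
  exact hg.of_nonneg_of_le (fun i => by positivity) fun i =>
    Real.rpow_le_rpow (norm_nonneg _) (h i) h2.le

lemma norm_one_add_imag (T : ℝ) (k : ℤ) :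
    1 ≤ ‖1 + Complex.I * (2 * Real.pi / T : ℝ) * k‖ ∧
      ‖Complex.I * (2 * Real.pi / T : ℝ) * k‖ ≤ ‖1 + Complex.I * (2 * Real.pi / T : ℝ) * k‖ := by
  set r : ℝ := 2 * Real.pi / T * k
  have e : Complex.I * (2 * Real.pi / T : ℝ) * k = (r : ℂ) * Complex.I := by
    simp only [r]
    push_cast
    ring
  rw [e]
  constructor
  · simpa using Complex.abs_re_le_norm (1 + (r : ℂ) * Complex.I)
  · simpa using Complex.abs_im_le_norm (1 + (r : ℂ) * Complex.I)

lemma one_add_imag_ne_zero (T : ℝ) (k : ℤ) : 1 + Complex.I * (2 * Real.pi / T : ℝ) * k ≠ 0 := by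
  intro h
  have := (norm_one_add_imag T k).1
  rw [h, norm_zero] at this
  linarith

/-- The resolvent weight `1 / (1 + j ω k)`. -/
noncomputable def weight (T : ℝ) (k : ℤ) : ℂ := (1 + Complex.I * (2 * Real.pi / T : ℝ) * k)⁻¹

lemma norm_weight_le (T : ℝ) (k : ℤ) : ‖weight T k‖ ≤ 1 := by
  rw [weight, norm_inv]
  exact inv_le_one_of_one_le₀ (norm_one_add_imag T k).1

lemma norm_imag_mul_weight_le (T : ℝ) (k : ℤ) :
    ‖Complex.I * (2 * Real.pi / T : ℝ) * k * weight T k‖ ≤ 1 := by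
  rw [weight, norm_mul, norm_inv, ← div_eq_mul_inv]
  exact div_le_one_of_le₀ (norm_one_add_imag T k).2 (norm_nonneg _)

/-- The operator `(1 + N)⁻¹`, whose range is the domain of `N`. -/
noncomputable def smoothing (T : ℝ) (X : EllTwo n) : EllTwo n :=
  ⟨fun p => weight T p.1 * X p, memlp_of_norm_le X.2 fun p => by
    rw [norm_mul]
    exact mul_le_of_le_one_left (norm_nonneg _) (norm_weight_le T p.1)⟩

lemma smoothing_apply (T : ℝ) (X : EllTwo n) (p : ℤ × Fin n) :
    smoothing T X p = weight T p.1 * X p := rfl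

lemma exists_actsTo_diagN_smoothing (T : ℝ) (X : EllTwo n) :
    ∃ Y, ActsTo (diagN n T) (smoothing T X) Y := by
  have hmem : Memℓp (fun p : ℤ × Fin n =>
      Complex.I * (2 * Real.pi / T : ℝ) * p.1 * weight T p.1 * X p) 2 :=
    memlp_of_norm_le X.2 fun p => by
      rw [norm_mul]
      exact mul_le_of_le_one_left (norm_nonneg _) (norm_imag_mul_weight_le T p.1)
  refine ⟨⟨_, hmem⟩, fun p => ?_⟩
  convert! hasSum_single (f := fun q => diagN n T p q * smoothing T X q) p ?_ using 1
  · simp [diagN, smoothing_apply, mul_assoc]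
  · intro r hr
    simp [diagN, Matrix.diagonal_apply_ne _ hr.symm]

/-- A matrix with square summable rows which is defined on the domain of `N` is bounded there for
the graph norm. -/
lemma exists_bounded_comp_smoothing (T : ℝ) {M : BlockMatrix n} (hrow : ∀ p, Memℓp (M p) 2)
    (h : ∀ X, ∃ Y, ActsTo M (smoothing T X) Y) :
    ∃ B : EllTwo n →L[ℂ] EllTwo n, ∀ X, ActsTo M (smoothing T X) (B X) := by
  -- Absorbing the weight into the columns gives an everywhere defined matrix, to which the closed
  -- graph theorem applies.
  have e : ∀ X Y, ActsTo (fun p q => M p q * weight T q.1 : BlockMatrix n) X Y ↔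
      ActsTo M (smoothing T X) Y := fun X Y => by
    simp only [ActsTo, smoothing_apply, mul_assoc]
  obtain ⟨B, hB⟩ := isBoundedOnEllTwo_of_forall_exists
    (M := (fun p q => M p q * weight T q.1 : BlockMatrix n))
    (fun p => memlp_of_norm_le (hrow p) fun q => by
      rw [norm_mul]
      exact mul_le_of_le_one_right (norm_nonneg _) (norm_weight_le T q.1))
    (fun X => by simpa only [e] using h X)
  exact ⟨B, fun X => (e X _).1 (hB X)⟩

lemma smoothing_single (T : ℝ) (q : ℤ × Fin n) :
    smoothing T (lp.single 2 q 1) = (lp.single 2 q (weight T q.1) : EllTwo n) := by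
  classical
  ext p
  rw [smoothing_apply]
  rcases eq_or_ne p q with rfl | h
  · simp
  · simp [Pi.single_eq_of_ne h]

lemma apply_of_actsTo_single {M : BlockMatrix n} {q : ℤ × Fin n} {c : ℂ} {Y : EllTwo n}
    (h : ActsTo M (lp.single 2 q c) Y) (p : ℤ × Fin n) : Y p = M p q * c := by
  classical
  refine (h p).unique ?_
  convert! hasSum_single (f := fun r => M p r * (lp.single 2 q c : EllTwo n) r) q ?_ using 1
  · simp
  · intro r hr
    simp [Pi.single_eq_of_ne hr]

/-- A Hermitian matrix defined on the domain of `N` has square summable rows. -/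
lemma memlp_row_of_isHermitian (T : ℝ) {M : BlockMatrix n} (hM : M.IsHermitian)
    (h : ∀ X, ∃ Y, ActsTo M (smoothing T X) Y) (p : ℤ × Fin n) : Memℓp (M p) 2 := by
  -- The factor `1 + jωk` cancels the weight: this vector is smoothed to the basis vector at `p`, so
  -- column `p` is square summable, and by Hermitian symmetry so is row `p`.
  obtain ⟨Y, hY⟩ := h (lp.single 2 p ((1 + Complex.I * (2 * Real.pi / T : ℝ) * p.1)))
  have e : smoothing T (lp.single 2 p ((1 + Complex.I * (2 * Real.pi / T : ℝ) * p.1))) =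
      (lp.single 2 p 1 : EllTwo n) := by
    classical
    ext q
    rw [smoothing_apply]
    rcases eq_or_ne q p with rfl | h
    · simp [weight, inv_mul_cancel₀ (one_add_imag_ne_zero T _), -Complex.ofReal_div]
    · simp [Pi.single_eq_of_ne h]
  rw [e] at hY
  refine memlp_of_norm_le Y.2 fun q => ?_
  rw [apply_of_actsTo_single hY q, mul_one, ← hM.apply, norm_star]

/-- This is how entrywise identities, known only on basis vectors, are extended to the whole space:
the operator must be bounded. -/
lemma continuousLinearMap_eq_zero (S : EllTwo n →L[ℂ] EllTwo n)
    (h : ∀ p q, inner ℂ (lp.single 2 p (1 : ℂ) : EllTwo n) (S (lp.single 2 q (1 : ℂ))) = 0) :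
    S = 0 := by
  classical
  have h1 : ∀ q, S (lp.single 2 q (1 : ℂ)) = 0 := fun q => by
    ext p
    simpa [lp.inner_single_left] using h p q
  ext1 X
  have h2 := (lp.hasSum_single (by norm_num : (2 : ENNReal) ≠ ⊤) X).mapL S
  have h3 : ∀ q, S (lp.single 2 q (X q)) = 0 := fun q => by
    have : (lp.single 2 q (X q) : EllTwo n) = X q • (lp.single 2 q (1 : ℂ) : EllTwo n) := by
      rw [← lp.single_smul]
      simp
    rw [this, map_smul, h1, smul_zero]
  simp only [h3] at h2
  exact h2.unique hasSum_zero

/-- The graph-norm bounded extension of the equation `D L + L^* D = 0` from basis vectors to the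
domain of `N`. -/
lemma inner_add_inner_eq_zero {T : ℝ} {D L : BlockMatrix n} {K G : EllTwo n →L[ℂ] EllTwo n}
    (hD : D.IsHermitian) (hK : ∀ X, ActsTo D (smoothing T X) (K X))
    (hG : ∀ X, ActsTo L (smoothing T X) (G X))
    (hDL : ∀ p q, ∃ s : ℂ, HasSum (fun r => D p r * L r q) s ∧
      HasSum (fun r => Lᴴ p r * D r q) (-s)) (X Y : EllTwo n) :
    inner ℂ (G X) (K Y) + inner ℂ (K X) (G Y) = 0 := by
  have h := continuousLinearMap_eq_zero (G.adjoint.comp K + K.adjoint.comp G) fun p q => by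
    rw [_root_.add_apply, inner_add_right, ContinuousLinearMap.comp_apply,
      ContinuousLinearMap.comp_apply, ContinuousLinearMap.adjoint_inner_right,
      ContinuousLinearMap.adjoint_inner_right]
    have k1 : ∀ q p, K (lp.single 2 q (1 : ℂ)) p = D p q * weight T q.1 := fun q p =>
      apply_of_actsTo_single (by simpa only [smoothing_single] using hK (lp.single 2 q (1 : ℂ))) p
    have g1 : ∀ q p, G (lp.single 2 q (1 : ℂ)) p = L p q * weight T q.1 := fun q p =>
      apply_of_actsTo_single (by simpa only [smoothing_single] using hG (lp.single 2 q (1 : ℂ))) p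
    obtain ⟨s, hs1, hs2⟩ := hDL p q
    have e1 : inner ℂ (G (lp.single 2 p (1 : ℂ))) (K (lp.single 2 q (1 : ℂ))) =
        conj (weight T p.1) * weight T q.1 * (-s) := by
      refine (lp.hasSum_inner (𝕜 := ℂ) _ _).unique ?_
      convert! hs2.mul_left (conj (weight T p.1) * weight T q.1) using 2 with r
      rw [RCLike.inner_apply', k1, g1, map_mul, Matrix.conjTranspose_apply, ← starRingEnd_apply]
      ring
    have e2 : inner ℂ (K (lp.single 2 p (1 : ℂ))) (G (lp.single 2 q (1 : ℂ))) =
        conj (weight T p.1) * weight T q.1 * s := by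
      refine (lp.hasSum_inner (𝕜 := ℂ) _ _).unique ?_
      convert! hs1.mul_left (conj (weight T p.1) * weight T q.1) using 2 with r
      rw [RCLike.inner_apply', k1, g1, map_mul, ← hD.apply p r, ← starRingEnd_apply]
      ring
    rw [e1, e2]
    ring
  have h2 := congrArg (fun S : EllTwo n →L[ℂ] EllTwo n => inner ℂ X (S Y)) h
  simpa [inner_add_right, ContinuousLinearMap.adjoint_inner_right] using h2

/-- Entrywise Hermitian symmetry becomes symmetry of the operator on the domain of `N`, again by
comparing bounded operators on basis vectors. -/
lemma inner_smoothing_comm {T : ℝ} {D : BlockMatrix n} {K : EllTwo n →L[ℂ] EllTwo n}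
    (hD : D.IsHermitian) (hK : ∀ X, ActsTo D (smoothing T X) (K X)) (X Y : EllTwo n) :
    inner ℂ (K X) (smoothing T Y) = inner ℂ (smoothing T X) (K Y) := by
  -- `smoothing` is a bare function; the identity matrix turns it into a continuous linear map `J`.
  obtain ⟨J, hJ⟩ := exists_bounded_comp_smoothing T (M := (1 : BlockMatrix n))
    (fun p => by
      classical
      have := (lp.single 2 p (1 : ℂ) : EllTwo n).2
      refine memlp_of_norm_le this fun q => ?_
      simp [Matrix.one_apply, Pi.single_apply, eq_comm])
    (fun X => ⟨smoothing T X, fun p => by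
      convert! hasSum_single (f := fun q => (1 : BlockMatrix n) p q * smoothing T X q) p ?_ using 1
      · simp
      · intro r hr
        simp [Matrix.one_apply_ne hr.symm]⟩)
  have hJ' : ∀ X, J X = smoothing T X := fun X => (hJ X).unique fun p => by
    convert! hasSum_single (f := fun q => (1 : BlockMatrix n) p q * smoothing T X q) p ?_ using 1
    · simp
    · intro r hr
      simp [Matrix.one_apply_ne hr.symm]
  have h := continuousLinearMap_eq_zero (K.adjoint.comp J - J.adjoint.comp K) fun p q => by
    classical
    have k1 : ∀ q p, K (lp.single 2 q (1 : ℂ)) p = D p q * weight T q.1 := fun q p =>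
      apply_of_actsTo_single (by simpa only [smoothing_single] using hK (lp.single 2 q (1 : ℂ))) p
    rw [_root_.sub_apply, inner_sub_right, ContinuousLinearMap.comp_apply,
      ContinuousLinearMap.comp_apply, ContinuousLinearMap.adjoint_inner_right,
      ContinuousLinearMap.adjoint_inner_right, hJ', hJ', smoothing_single, smoothing_single,
      lp.inner_single_left, lp.inner_single_right, k1, k1, RCLike.inner_apply',
      RCLike.inner_apply', map_mul, ← hD.apply p q, ← starRingEnd_apply]
    ring
  have h2 := congrArg (fun S : EllTwo n →L[ℂ] EllTwo n => inner ℂ X (S Y)) h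
  simp only [_root_.sub_apply, inner_sub_right, ContinuousLinearMap.comp_apply,
      ContinuousLinearMap.adjoint_inner_right, hJ', _root_.zero_apply,
      inner_zero_right] at h2
  exact sub_eq_zero.1 h2

section Exp

open scoped Matrix.Norms.Operator

lemma hasDerivAt_matrix_exp (R : Matrix (Fin n) (Fin n) ℂ) (t : ℝ) (i j : Fin n) :
    HasDerivAt (fun s : ℝ => exp (s • R) i j) ((exp (t • R) * R) i j) t := by
  have h := hasDerivAt_exp_smul_const (𝕂 := ℝ) R t
  exact hasDerivAt_pi.1 (hasDerivAt_pi.1 h i) j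

lemma continuous_matrix_exp (R : Matrix (Fin n) (Fin n) ℂ) :
    Continuous fun s : ℝ => exp (s • R) :=
  continuous_iff_continuousAt.2 fun t => (hasDerivAt_exp_smul_const (𝕂 := ℝ) R t).continuousAt

end Exp

lemma matACDeriv_exp {T : ℝ} (hT : 0 < T) (R : Matrix (Fin n) (Fin n) ℂ) :
    MatACDeriv T (fun t => exp (t • R)) fun t => exp (t • R) * R := fun i j => by
  refine .of_contDiff hT ?_ fun t => hasDerivAt_matrix_exp R t i j
  rw [contDiff_one_iff_deriv]
  refine ⟨fun t => (hasDerivAt_matrix_exp R t i j).differentiableAt, ?_⟩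
  have e : deriv (fun s : ℝ => exp (s • R) i j) = fun t => (exp (t • R) * R) i j :=
    funext fun t => (hasDerivAt_matrix_exp R t i j).deriv
  rw [e]
  exact ((continuous_matrix_exp R).matrix_mul continuous_const).matrix_elem i j

lemma MatACDeriv.exp_mode_smul {T : ℝ} (hT : 0 < T) {F F' : ℝ → Matrix (Fin n) (Fin n) ℂ}
    (hF : MatACDeriv T F F') (k : ℤ) :
    MatACDeriv T (fun t => Complex.exp (-(Complex.I * (2 * Real.pi / T : ℝ) * k * t)) • F t)
      fun t => Complex.exp (-(Complex.I * (2 * Real.pi / T : ℝ) * k * t)) •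
        (F' t - (Complex.I * (2 * Real.pi / T : ℝ) * k) • F t) := fun i j => by
  refine ((HasACDeriv.exp_mode hT k).mul hT (hF i j)).congr_deriv (.of_forall fun t => ?_)
  simp only [Matrix.smul_apply, Matrix.sub_apply, smul_eq_mul]
  ring

/-! ### The generator `A - N` on periodic absolutely continuous functions. -/

/-- The periodic resolvent problem `y' + y = x`. -/
lemma exists_resolvent {T : ℝ} (hT : 0 < T) {x : ℝ → ℂ}
    (hx : Integrable x (volume.restrict (Ioc 0 T))) :
    ∃ y, HasACDeriv T y (fun t => x t - y t) ∧ y 0 = y T := by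
  have hcd : ContDiff ℝ 1 fun t : ℝ => Complex.exp (-t) := by
    have : ContDiff ℝ 1 fun t : ℝ => (t : ℂ) := Complex.ofRealCLM.contDiff
    fun_prop
  have hE : HasACDeriv T (fun t : ℝ => Complex.exp (-t)) fun t => -Complex.exp (-t) := by
    refine .of_contDiff hT hcd fun t => ?_
    simpa using (Complex.ofRealCLM.hasDerivAt (x := t)).fun_neg.cexp
  have hi : Integrable (fun t : ℝ => Complex.exp t * x t) (volume.restrict (Ioc 0 T)) := by
    refine Integrable.bdd_mul (c := Real.exp T) hx
      (by fun_prop) ?_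
    rw [ae_restrict_iff' measurableSet_Ioc]
    refine .of_forall fun t ht => ?_
    rw [Complex.norm_exp_ofReal]
    exact Real.exp_le_exp.2 ht.2
  set I := ∫ t in (0 : ℝ)..T, Complex.exp t * x t
  have hne : (1 : ℂ) - Complex.exp (-T) ≠ 0 := by
    rw [sub_ne_zero, ← Complex.ofReal_neg, ← Complex.ofReal_exp]
    have h : Real.exp (-T) < 1 := by simpa using hT
    exact_mod_cast h.ne'
  -- `C = y(0)` is forced by periodicity, `C = exp (-T) (C + I)`.
  set C := Complex.exp (-T) * I / (1 - Complex.exp (-T))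
  refine ⟨fun t => Complex.exp (-t) * (C + ∫ s in (0 : ℝ)..t, Complex.exp s * x s), ?_, ?_⟩
  · refine (hE.mul hT (.of_integrable hT C hi)).congr_deriv (.of_forall fun t => ?_)
    have : Complex.exp (-(t : ℂ)) * Complex.exp t = 1 := by rw [← Complex.exp_add]; simp
    linear_combination x t * this
  · change _ = Complex.exp (-T) * (C + I)
    simp only [Complex.ofReal_zero, neg_zero, Complex.exp_zero, one_mul,
      intervalIntegral.integral_same, add_zero, C]
    field_simp
    ring

/-- The sequence of `y` is the smoothing of the sequence of `y + y'`. -/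
lemma represents_smoothing {T : ℝ} (hT : 0 < T) {X : EllTwo n} {x y : ℝ → Fin n → ℂ}
    (hX : Represents T X x) (hy : ∀ a, HasACDeriv T (fun t => y t a) fun t => x t a - y t a)
    (hy0 : y 0 = y T) : Represents T (smoothing T X) y := by
  refine ⟨fun a => (hy a).sqInt hT, fun p => ?_⟩
  have h := (hy p.2).fc_deriv hT (by rw [hy0]) p.1
  rw [fc_sub hT (hX.sqInt _).integrable ((hy p.2).sqInt hT).integrable] at h
  rw [smoothing_apply, hX.coeff, weight, inv_mul_eq_iff_eq_mul₀ (one_add_imag_ne_zero T _)]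
  linear_combination h

/-- The operator `A - N` is `y ↦ A y - y'` on sequences of absolutely continuous functions. -/
lemma actsTo_generator {T : ℝ} (hT : 0 < T) {A : ℝ → Matrix (Fin n) (Fin n) ℂ}
    (hA : ∀ a b, SqInt T fun t => A t a b) {Y Z : EllTwo n} {y y' : ℝ → Fin n → ℂ}
    (hY : Represents T Y y) (hy : ∀ a, HasACDeriv T (fun t => y t a) fun t => y' t a)
    (hy0 : y 0 = y T) (hZ : Represents T Z fun t => A t *ᵥ y t - y' t) :
    ActsTo (toep T A - diagN n T) Y Z := by
  intro p
  have h1 := hasSum_toep_mulVec hT hA hY p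
  have h2 : HasSum (fun q => diagN n T p q * Y q) (fc T (fun t => y' t p.2) p.1) := by
    convert! hasSum_single (f := fun q => diagN n T p q * Y q) p ?_ using 1
    · rw [(hy p.2).fc_deriv hT (by rw [hy0]), hY.coeff]
      simp [diagN]
    · intro r hr
      simp [diagN, Matrix.diagonal_apply_ne _ hr.symm]
  have hi : Integrable (fun t => (A t *ᵥ y t) p.2) (volume.restrict (Ioc 0 T)) := by
    simpa [mulVec, dotProduct] using
      integrable_finsetSum Finset.univ fun b _ => (hA p.2 b).integrable_mul (hY.sqInt b)
  rw [hZ.coeff]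
  simp only [Pi.sub_apply]
  rw [fc_sub hT hi (hy p.2).int]
  simpa only [Matrix.sub_apply, sub_mul] using h1.sub h2

lemma sqInt_mulVec_of_top {T : ℝ} {A : ℝ → Matrix (Fin n) (Fin n) ℂ}
    (hA : ∀ a b, SqInt T fun t => A t a b) {y : ℝ → Fin n → ℂ}
    (hy : ∀ a, MemLp (fun t => y t a) ⊤ (volume.restrict (Ioc 0 T))) (a : Fin n) :
    SqInt T fun t => (A t *ᵥ y t) a := by
  simpa [mulVec, dotProduct, mul_comm] using
    memLp_finsetSum Finset.univ fun b _ => memLp_mul_top (hy b) (hA a b)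

lemma memlp_row_generator {T : ℝ} (hT : 0 < T) {A : ℝ → Matrix (Fin n) (Fin n) ℂ}
    (hA : ∀ a b, SqInt T fun t => A t a b) (p : ℤ × Fin n) :
    Memℓp ((toep T A - diagN n T) p) 2 := by
  classical
  have h : Memℓp (diagN n T p) 2 := by
    refine memlp_of_norm_le
      (lp.single 2 p (Complex.I * (2 * Real.pi / T : ℝ) * p.1) : EllTwo n).2 fun q => ?_
    rcases eq_or_ne q p with rfl | hq
    · simp [diagN]
    · simp [diagN, Matrix.diagonal_apply_ne _ hq.symm]
  exact (memlp_row_toep hT hA p).sub h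

/-- Vectors in the domain of `N` correspond to bounded functions `y`, so `A y` is square integrable
although `A` need not be bounded. -/
lemma exists_generator_comp_smoothing {T : ℝ} (hT : 0 < T) {A : ℝ → Matrix (Fin n) (Fin n) ℂ}
    (hA : ∀ a b, SqInt T fun t => A t a b) :
    ∃ G : EllTwo n →L[ℂ] EllTwo n, ∀ X, ActsTo (toep T A - diagN n T) (smoothing T X) (G X) := by
  refine exists_bounded_comp_smoothing T (memlp_row_generator hT hA) fun X => ?_
  obtain ⟨x, hx⟩ := exists_function_represents hT X
  choose y hy hy0 using fun a => exists_resolvent hT (hx.sqInt a).integrable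
  have hS : Represents T (smoothing T X) fun t a => y a t :=
    represents_smoothing hT hx hy (funext hy0)
  obtain ⟨Z, hZ⟩ := exists_sequence_represents hT
    (x := fun t => (A t *ᵥ fun a => y a t) - fun a => x t a - y a t) fun a =>
      (sqInt_mulVec_of_top hA (fun a => (hy a).memLp_top hT) a).sub
        ((hx.sqInt a).sub (hS.sqInt a))
  exact ⟨Z, actsTo_generator hT hA hS hy (funext hy0) hZ⟩

/-! ### Floquet normal form and test vectors. -/

/-- A periodic solution `Z` of `Z' = A Z - Z R` together with a flow `E` of `R`. -/
structure FloquetPair (T : ℝ) (A : ℝ → Matrix (Fin n) (Fin n) ℂ) (M R : Matrix (Fin n) (Fin n) ℂ)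
    (Z E : ℝ → Matrix (Fin n) (Fin n) ℂ) : Prop where
  deriv : MatACDeriv T Z fun t => A t * Z t - Z t * R
  periodic : Z 0 = Z T
  flow : MatACDeriv T E fun t => R * E t
  flow_zero : E 0 = 1
  flow_period : E T = M

/-- The Floquet normal form of the fundamental matrix. -/
lemma exists_floquetPair {T : ℝ} (hT : 0 < T) {A Φ Ψ : ℝ → Matrix (Fin n) (Fin n) ℂ}
    (hΦ : MatACDeriv T Φ fun t => A t * Φ t) (hΦ0 : Φ 0 = 1)
    (hΨ : ∀ t ∈ Icc 0 T, Ψ t * Φ t = 1) :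
    ∃ R Z E, FloquetPair T A (Φ T) R Z E ∧ ∀ t ∈ Icc 0 T, ∃ W, W * Z t = 1 := by
  obtain ⟨S, hS⟩ := exists_matrix_exp_eq (hΨ T ⟨hT.le, le_rfl⟩)
  set R : Matrix (Fin n) (Fin n) ℂ := T⁻¹ • S
  have hTR : exp (T • R) = Φ T := by
    rw [← hS]
    simp only [R]
    rw [smul_smul, mul_inv_cancel₀ hT.ne', one_smul]
  have hinv : ∀ t : ℝ, exp (t • R) * exp (t • -R) = 1 := fun t => by
    rw [smul_neg, ← Matrix.exp_add_of_commute _ _ (Commute.refl (t • R)).neg_right]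
    simp
  refine ⟨R, fun t => Φ t * exp (t • -R), fun t => exp (t • R), ⟨?_, ?_, ?_, by simp, hTR⟩,
    fun t ht => ⟨exp (t • R) * Ψ t, ?_⟩⟩
  · refine (hΦ.mul hT (matACDeriv_exp hT (-R))).congr_deriv (.of_forall fun t => ?_)
    simp [Matrix.mul_assoc, sub_eq_add_neg]
  · have := hinv T
    rw [hTR] at this
    simp only [this, hΦ0]
    simp
  · refine (matACDeriv_exp hT R).congr_deriv (.of_forall fun t => ?_)
    exact ((Commute.refl R).smul_right t).exp_right.eq.symm
  · rw [Matrix.mul_assoc, ← Matrix.mul_assoc (Ψ t), hΨ t ht, Matrix.one_mul, hinv]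

/-- Shifting the Floquet exponents by a multiple of `j ω`. -/
lemma FloquetPair.shift {T : ℝ} (hT : 0 < T) {A Z E : ℝ → Matrix (Fin n) (Fin n) ℂ}
    {M R : Matrix (Fin n) (Fin n) ℂ} (h : FloquetPair T A M R Z E) (k : ℤ) :
    FloquetPair T A M (R + (Complex.I * (2 * Real.pi / T : ℝ) * k) • 1)
      (fun t => Complex.exp (-(Complex.I * (2 * Real.pi / T : ℝ) * k * t)) • Z t)
      fun t => Complex.exp (-(Complex.I * (2 * Real.pi / T : ℝ) * (-k : ℤ) * t)) • E t := by
  have hper : ∀ k : ℤ, Complex.exp (-(Complex.I * (2 * Real.pi / T : ℝ) * k * T)) = 1 := fun k => by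
    rw [← fourier_neg_eq_exp, AddCircle.coe_period]
    simp
  refine ⟨?_, ?_, ?_, ?_, ?_⟩
  · refine (h.deriv.exp_mode_smul hT k).congr_deriv (.of_forall fun t => ?_)
    simp only [Matrix.mul_smul, Matrix.smul_mul, Matrix.mul_add, Matrix.mul_one, smul_sub,
      smul_comm (Complex.I * _ * _)]
    abel
  · simp only [hper, ← h.periodic]
    simp
  · refine (h.flow.exp_mode_smul hT (-k)).congr_deriv (.of_forall fun t => ?_)
    simp only [Matrix.mul_smul, Matrix.smul_mul, Matrix.add_mul, Matrix.one_mul, smul_sub, smul_add]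
    push_cast
    rw [mul_neg, neg_smul, smul_neg, sub_neg_eq_add]
  · simp [h.flow_zero]
  · simp only [hper, h.flow_period, one_smul]

/-- The derivative of `E₁^* B E₂` is `E₁^* (R₁^* B + B R₂) E₂ = 0`; comparing `0` and `T` gives `M^*
B M = B`. Both pairs share `M`, since shifting exponents by `jωk` leaves the period map unchanged.
-/
lemma eq_zero_of_sylvester {T : ℝ} (hT : 0 < T) {A Z₁ E₁ Z₂ E₂ : ℝ → Matrix (Fin n) (Fin n) ℂ}
    {M R₁ R₂ B : Matrix (Fin n) (Fin n) ℂ} (h₁ : FloquetPair T A M R₁ Z₁ E₁)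
    (h₂ : FloquetPair T A M R₂ Z₂ E₂)
    (hM : ∀ v : Fin n → ℂ, Tendsto (fun k : ℕ => (M ^ k) *ᵥ v) atTop (nhds 0))
    (hB : R₁ᴴ * B + B * R₂ = 0) : B = 0 := by
  refine eq_zero_of_conjTranspose_mul_mul_eq hM ?_
  have h : MatACDeriv T (fun t => (E₁ t)ᴴ * B * E₂ t) fun _ => 0 := by
    refine ((h₁.flow.conjTranspose.mul hT (.const B)).mul hT h₂.flow).congr_deriv
      (.of_forall fun t => ?_)
    have : (E₁ t)ᴴ * (R₁ᴴ * B + B * R₂) * E₂ t = 0 := by simp [hB]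
    simpa [Matrix.conjTranspose_mul, Matrix.mul_assoc, Matrix.mul_add, Matrix.add_mul] using this
  have := h.eq_of_deriv_zero hT (s := T) ⟨hT.le, le_rfl⟩
  simpa [h₁.flow_zero, h₂.flow_zero, h₁.flow_period, h₂.flow_period] using this

/-- The columns of a Floquet pair in the domain of `N`, and the action of `A - N` on them. -/
lemma FloquetPair.exists_columns {T : ℝ} (hT : 0 < T) {A Z E : ℝ → Matrix (Fin n) (Fin n) ℂ}
    {M R : Matrix (Fin n) (Fin n) ℂ} (hA : ∀ a b, SqInt T fun t => A t a b)
    (h : FloquetPair T A M R Z E) :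
    ∃ X : Fin n → EllTwo n, (∀ j, Represents T (smoothing T (X j)) fun t a => Z t a j) ∧
      ∀ j, ActsTo (toep T A - diagN n T) (smoothing T (X j)) (∑ i, R i j • smoothing T (X i)) := by
  have htop : ∀ a b, MemLp (fun t => Z t a b) ⊤ (volume.restrict (Ioc 0 T)) :=
    fun a b => (h.deriv a b).memLp_top hT
  have hsq : ∀ a b, SqInt T fun t => Z t a b := fun a b => sqInt_of_top (htop a b)
  have hcol : ∀ t j, (fun a => (A t * Z t - Z t * R) a j) =
      (A t *ᵥ fun a => Z t a j) - ∑ i, R i j • fun a => Z t a i := fun t j => by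
    ext a
    simp [Matrix.mul_apply, mulVec, dotProduct, mul_comm]
  have hZR : ∀ j a, SqInt T fun t => (∑ i, R i j • fun a => Z t a i : Fin n → ℂ) a := fun j a => by
    simpa using memLp_finsetSum Finset.univ fun i _ => (hsq a i).const_mul (R i j)
  -- `X j` is the sequence of `z' + z` for the `j`-th column `z` of `Z`, so that smoothing returns
  -- `z`.
  choose X hX using fun j => exists_sequence_represents hT
    (x := fun t a => (A t * Z t - Z t * R) a j + Z t a j) fun a => by
      have h1 : SqInt T fun t => (A t *ᵥ fun a => Z t a j) a :=
        sqInt_mulVec_of_top hA (fun a => htop a j) a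
      have h2 : SqInt T fun t => (A t * Z t - Z t * R) a j := by
        have e : ∀ t, (A t * Z t - Z t * R) a j =
            (A t *ᵥ fun a => Z t a j) a - (∑ i, R i j • fun a => Z t a i : Fin n → ℂ) a :=
          fun t => congrFun (hcol t j) a
        simp only [e]
        exact h1.sub (hZR j a)
      exact h2.add (hsq a j)
  have hS : ∀ j, Represents T (smoothing T (X j)) fun t a => Z t a j := fun j =>
    represents_smoothing hT (hX j) (fun a => by simpa using h.deriv a j)
      (funext fun a => by rw [h.periodic])
  refine ⟨X, hS, fun j => ?_⟩
  refine actsTo_generator hT hA (hS j) (h.deriv · j) (funext fun a => by rw [h.periodic]) ?_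
  refine (Represents.sum_smul hT Finset.univ (R · j) hS).congr_ae hT (.of_forall fun t => ?_)
  dsimp only
  rw [hcol]
  abel

/-- The modulated columns of an invertible matrix function are total in `ℓ²`. -/
lemma eq_zero_of_inner_columns {T : ℝ} (hT : 0 < T) {Z : ℝ → Matrix (Fin n) (Fin n) ℂ}
    (hZ : ∀ a b, MemLp (fun t => Z t a b) ⊤ (volume.restrict (Ioc 0 T)))
    (hinv : ∀ t ∈ Icc 0 T, ∃ W, W * Z t = 1) {X : ℤ → Fin n → EllTwo n}
    (hX : ∀ k j, Represents T (X k j) fun t a =>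
      (Complex.exp (-(Complex.I * (2 * Real.pi / T : ℝ) * k * t)) • Z t) a j)
    {Y : EllTwo n} (h : ∀ k j, inner ℂ (X k j) Y = 0) : Y = 0 := by
  obtain ⟨y, hy⟩ := exists_function_represents hT Y
  have hsq : ∀ j, SqInt T fun t => ((Z t)ᴴ *ᵥ y t) j := fun j =>
    sqInt_mulVec (F := fun t => (Z t)ᴴ) (fun a b => (hZ b a).star) hy.sqInt j
  have hz : ∀ j, (fun t => ((Z t)ᴴ *ᵥ y t) j) =ᵐ[volume.restrict (Ioc 0 T)] fun _ => 0 := fun j => by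
    refine ae_eq_of_fc_eq hT (hsq j) MemLp.zero' fun k => ?_
    -- Conjugating the modulation `-k` turns the inner product with that column into the `k`-th
    -- coefficient of `Z^* y`.
    rw [fc_zero, ← h (-k) j, (hX _ _).inner_eq hT hy]
    unfold fc
    congr 1
    refine intervalIntegral.integral_congr fun t _ => ?_
    have := conj_exp_mode T (-k) t
    rw [neg_neg] at this
    simp only [dotProduct, mulVec, Matrix.smul_apply, Pi.star_apply, smul_eq_mul, star_mul',
      Finset.sum_mul, conjTranspose_apply]
    refine Finset.sum_congr rfl fun a _ => ?_
    rw [← starRingEnd_apply (Complex.exp _), this]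
    ring
  refine hy.eq_zero hT ?_
  filter_upwards [ae_all_iff.2 hz, ae_restrict_mem measurableSet_Ioc] with t ht hm
  obtain ⟨W, hW⟩ := hinv t (Ioc_subset_Icc_self hm)
  have h1 : (Z t)ᴴ * Wᴴ = 1 := by rw [← Matrix.conjTranspose_mul, hW, Matrix.conjTranspose_one]
  have h2 : Wᴴ * (Z t)ᴴ = 1 := mul_eq_one_comm.1 h1
  rw [← Matrix.one_mulVec (y t), ← h2, ← Matrix.mulVec_mulVec, funext ht]
  exact Matrix.mulVec_zero _

/-! ### Uniqueness for the harmonic equation. -/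

/-- The homogeneous harmonic Lyapunov equation has only the trivial Hermitian solution when the
monodromy matrix is stable. -/
lemma eq_zero_of_homogeneous {T : ℝ} (hT : 0 < T) {A Φ Ψ : ℝ → Matrix (Fin n) (Fin n) ℂ}
    (hA : ∀ a b, SqInt T fun t => A t a b)
    (hΦ : MatACDeriv T Φ fun t => A t * Φ t) (hΦ0 : Φ 0 = 1)
    (hΨ : ∀ t ∈ Icc 0 T, Ψ t * Φ t = 1)
    (hM : ∀ v : Fin n → ℂ, Tendsto (fun k : ℕ => (Φ T ^ k) *ᵥ v) atTop (nhds 0))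
    {D : BlockMatrix n} (hD : D.IsHermitian) (hdom : ∀ X, ∃ Y, ActsTo D (smoothing T X) Y)
    (hDL : ∀ p q, ∃ s : ℂ, HasSum (fun r => D p r * (toep T A - diagN n T) r q) s ∧
      HasSum (fun r => (toep T A - diagN n T)ᴴ p r * D r q) (-s)) : D = 0 := by
  obtain ⟨G, hG⟩ := exists_generator_comp_smoothing hT hA
  obtain ⟨K, hK⟩ := exists_bounded_comp_smoothing T (memlp_row_of_isHermitian T hD hdom) hdom
  obtain ⟨R, Z, E, hF, hinv⟩ := exists_floquetPair hT hΦ hΦ0 hΨ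
  choose X hX hGX using fun k => (hF.shift hT k).exists_columns hT hA
  have hZ : ∀ a b, MemLp (fun t => Z t a b) ⊤ (volume.restrict (Ioc 0 T)) :=
    fun a b => (hF.deriv a b).memLp_top hT
  have hB : ∀ k l i j, inner ℂ (smoothing T (X k i)) (K (X l j)) = 0 := by
    intro k l
    -- The form of `D` between the families of modulations `k` and `l`; invariance of both under `A
    -- - N` turns the operator identity into a Sylvester equation.
    let B : Matrix (Fin n) (Fin n) ℂ := of fun i j => inner ℂ (smoothing T (X k i)) (K (X l j))
    have : B = 0 := by
      refine eq_zero_of_sylvester hT (hF.shift hT k) (hF.shift hT l) hM ?_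
      ext i j
      have h := inner_add_inner_eq_zero hD hK hG hDL (X k i) (X l j)
      rw [(hG _).unique (hGX k i), (hG _).unique (hGX l j), sum_inner, inner_sum] at h
      simp only [inner_smul_left, inner_smul_right, inner_smoothing_comm hD hK] at h
      simp only [Matrix.add_apply, Matrix.mul_apply (M := B), Matrix.mul_apply, Matrix.conjTranspose_apply, Matrix.zero_apply]
      rw [← h]
      congr 1
      exact Finset.sum_congr rfl fun c _ => mul_comm _ _
    exact fun i j => congrFun (congrFun this i) j
  have hK0 : ∀ l j, K (X l j) = 0 := fun l j =>
    eq_zero_of_inner_columns hT hZ hinv hX fun k i => hB k l i j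
  -- Symmetry moves `D` onto the columns, where it is already zero, and totality is used a second
  -- time.
  have hK1 : ∀ W, K W = 0 := fun W => eq_zero_of_inner_columns hT hZ hinv hX fun k i => by
    rw [← inner_smoothing_comm hD hK, hK0, inner_zero_left]
  ext p q
  have h := hK (lp.single 2 q (1 : ℂ))
  rw [smoothing_single, hK1] at h
  have h1 := apply_of_actsTo_single h p
  have hw : weight T q.1 ≠ 0 := inv_ne_zero (one_add_imag_ne_zero T _)
  simpa [hw] using h1.symm

/-- A periodic solution of the Lyapunov differential equation yields the only solution of the
harmonic Lyapunov equation. -/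
lemma isUniqueHarmonicSolution_toep {T : ℝ} (hT : 0 < T) {A Q P : ℝ → Matrix (Fin n) (Fin n) ℂ}
    (hA : ∀ a b, SqInt T fun t => A t a b) (hQ : ∀ a b, SqInt T fun t => Q t a b)
    (hQpos : ∀ᵐ t ∂volume.restrict (Ioc 0 T), (Q t).PosDef)
    (hP : MatACDeriv T P fun t => -((A t)ᴴ * P t + P t * A t + Q t)) (hP0 : P 0 = P T)
    (hpos : ∀ t, (P t).PosDef) :
    IsUniqueHarmonicSolution T (toep T A) (toep T Q) (toep T P) := by
  have hsol := isHarmonicLyapunovSolution_toep hT hA hQ hP hP0 hpos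
  refine ⟨hsol, fun P' h' => ?_⟩
  obtain ⟨Φ, Ψ, hΦ, hΦ0, hΨ⟩ := exists_fundamental_matrix hT fun i j => (hA i j).integrable
  -- The given solution is itself the Lyapunov function: since `P 0 = P T`, decay over one period is
  -- a discrete Lyapunov inequality for `Φ T`.
  have hM := tendsto_pow_mulVec_zero (H := P 0) (M := Φ T)
    (fun v => (Complex.le_def.1 ((hpos 0).posSemidef.dotProduct_mulVec_nonneg v)).1)
    fun v hv => by
      have := re_quadratic_flow_lt hT hP hΦ hΨ hQpos le_rfl hT le_rfl hv
      rwa [← hP0, hΦ0, Matrix.one_mulVec] at this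
  refine sub_eq_zero.1 (eq_zero_of_homogeneous hT hA hΦ hΦ0 hΨ hM (h'.hermitian.sub hsol.hermitian)
    (fun X => ?_) fun p q => ?_)
  · obtain ⟨N, hN⟩ := exists_actsTo_diagN_smoothing T X
    obtain ⟨Y₁, h₁⟩ := h'.domain _ _ hN
    obtain ⟨Y₂, h₂⟩ := hsol.domain _ _ hN
    exact ⟨Y₁ - Y₂, fun p => by simpa [sub_mul] using (h₁ p).sub (h₂ p)⟩
  · have l := (h'.converges_left p q).hasSum.sub (hsol.converges_left p q).hasSum
    have r := (h'.converges_right p q).hasSum.sub (hsol.converges_right p q).hasSum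
    have e₁ := congrFun (congrFun h'.equation p) q
    have e₂ := congrFun (congrFun hsol.equation p) q
    simp only [Matrix.add_apply, infMul, Matrix.zero_apply] at e₁ e₂
    generalize toep T A - diagN n T = L at l r e₁ e₂ ⊢
    refine ⟨_, by simpa only [Matrix.sub_apply, sub_mul] using! l, ?_⟩
    convert! r using 1
    · ext s
      simp only [Matrix.sub_apply, mul_sub]
    · linear_combination e₂ - e₁

/-! ### From one period to the line, and uniqueness of periodic solutions. -/

lemma ae_eq_of_forall_translate {α : Type*} {T : ℝ} (hT : 0 < T) {F G : ℝ → α}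
    (h : ∀ m : ℤ, ∀ᵐ t ∂volume.restrict (Ioc 0 T), F (t + m * T) = G (t + m * T)) :
    F =ᵐ[volume] G := by
  have h1 : ∀ m : ℤ, ∀ᵐ s : ℝ, s - m * T ∈ Ioc 0 T → F s = G s := fun m => by
    have h2 := (ae_restrict_iff' measurableSet_Ioc).1 (h m)
    have h3 := (measurePreserving_sub_right volume ((m : ℝ) * T)).quasiMeasurePreserving.ae h2
    filter_upwards [h3] with s hs hm
    simpa using hs hm
  filter_upwards [ae_all_iff.2 h1] with s hs
  have h4 := sub_toIocDiv_zsmul_mem_Ioc hT 0 s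
  rw [zero_add, zsmul_eq_mul] at h4
  exact hs _ h4

lemma ae_eq_of_periodic {α : Type*} {T : ℝ} (hT : 0 < T) {F G : ℝ → α}
    (hF : Function.Periodic F T) (hG : Function.Periodic G T)
    (h : F =ᵐ[volume.restrict (Ioc 0 T)] G) : F =ᵐ[volume] G :=
  ae_eq_of_forall_translate hT fun m => by
    filter_upwards [h] with t ht
    rw [hF.int_mul, hG.int_mul, ht]

/-- Periodic matrix functions with continuous entries agreeing almost everywhere on a period are
equal. -/
lemma eq_of_periodic_of_ae_eq {T : ℝ} (hT : 0 < T) {F G : ℝ → Matrix (Fin n) (Fin n) ℝ}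
    (hF : Function.Periodic F T) (hG : Function.Periodic G T)
    (hFc : ∀ i j, Continuous fun t => F t i j) (hGc : ∀ i j, Continuous fun t => G t i j)
    (h : F =ᵐ[volume.restrict (Ioc 0 T)] G) : F = G := by
  have h1 := ae_eq_of_periodic hT hF hG h
  exact (Continuous.ae_eq_iff_eq volume (continuous_matrix hFc) (continuous_matrix hGc)).1 h1

lemma ae_eq_of_complexify_ae_eq {μ : Measure ℝ} {F G : ℝ → Matrix (Fin n) (Fin n) ℝ}
    (h : complexify F =ᵐ[μ] complexify G) : F =ᵐ[μ] G := by
  filter_upwards [h] with t ht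
  ext i j
  exact Complex.ofReal_injective (congrFun (congrFun ht i) j)

lemma ae_posDef_complexify {Q : ℝ → Matrix (Fin n) (Fin n) ℝ} (hQ : ∀ᵐ t : ℝ, (Q t).PosDef)
    (s : Set ℝ) : ∀ᵐ t ∂volume.restrict s, (complexify Q t).PosDef := by
  filter_upwards [ae_restrict_of_ae hQ] with t ht using posDef_complexify ht

lemma conjTranspose_complexify (F : ℝ → Matrix (Fin n) (Fin n) ℝ) (t : ℝ) :
    (complexify F t)ᴴ = complexify (fun s => (F s)ᵀ) t := by
  ext i j
  simp [complexify]

lemma complexify_lyapunov (A P Q : ℝ → Matrix (Fin n) (Fin n) ℝ) (t : ℝ) (i j : Fin n) :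
    ((complexify A t)ᴴ * complexify P t + complexify P t * complexify A t + complexify Q t) i j =
      ((((A t)ᵀ * P t + P t * A t + Q t) i j : ℝ) : ℂ) := by
  simp [complexify, Matrix.mul_apply]

lemma continuous_of_absolutelyContinuous {f : ℝ → ℝ}
    (h : ∀ a b, AbsolutelyContinuousOnInterval f a b) : Continuous f :=
  continuous_iff_continuousAt.2 fun t => by
    have h1 := (h (t - 1) (t + 1)).continuousOn
    rw [uIcc_of_le (by linarith)] at h1
    exact h1.continuousAt (Icc_mem_nhds (by linarith) (by linarith))

section Periodic

variable {T : ℝ} {A Q P : ℝ → Matrix (Fin n) (Fin n) ℝ}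

lemma integrable_lyapunov {A Q P : ℝ → Matrix (Fin n) (Fin n) ℂ}
    (hA : ∀ a b, SqInt T fun t => A t a b)
    (hP : ∀ a b, SqInt T fun t => P t a b) (hQ : ∀ a b, SqInt T fun t => Q t a b) (a b : Fin n) :
    Integrable (fun t => ((A t)ᴴ * P t + P t * A t + Q t) a b) (volume.restrict (Ioc 0 T)) := by
  simp only [Matrix.add_apply]
  exact ((integrable_matrix_mul_apply (F := fun t => (A t)ᴴ) (fun a b => (hA b a).conj) hP a b).add
    (integrable_matrix_mul_apply hP hA a b)).add (hQ a b).integrable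

lemma IsPeriodicLyapunovSolution.continuous (h : IsPeriodicLyapunovSolution T A Q P)
    (i j : Fin n) : Continuous fun t => P t i j :=
  continuous_of_absolutelyContinuous (h.absCont i j)

lemma memLp_top_complexify_of_continuous (hc : ∀ i j, Continuous fun t => P t i j) (i j : Fin n) :
    MemLp (fun t => complexify P t i j) ⊤ (volume.restrict (Ioc 0 T)) := by
  have h1 : Continuous fun t => complexify P t i j := Complex.continuous_ofReal.comp (hc i j)
  obtain ⟨C, hC⟩ := isCompact_Icc.exists_bound_of_continuousOn (s := Icc 0 T) h1.continuousOn
  refine memLp_top_of_bound h1.aestronglyMeasurable C ?_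
  rw [ae_restrict_iff' measurableSet_Ioc]
  exact .of_forall fun t ht => hC t (Ioc_subset_Icc_self ht)

lemma matACDeriv_complexify (hA : ∀ a b, SqInt T fun t => complexify A t a b)
    (hQ : ∀ a b, SqInt T fun t => complexify Q t a b)
    (hac : ∀ i j a b, AbsolutelyContinuousOnInterval (fun t => P t i j) a b)
    (heq : ∀ᵐ t : ℝ, ∀ i j, HasDerivAt (fun s => P s i j)
      (-(((A t).transpose * P t + P t * A t + Q t) i j)) t) :
    MatACDeriv T (complexify P) fun t => -((complexify A t)ᴴ * complexify P t +
      complexify P t * complexify A t + complexify Q t) := by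
  have hP : ∀ a b, SqInt T fun t => complexify P t a b := fun a b => sqInt_of_top
    (memLp_top_complexify_of_continuous (fun i j => continuous_of_absolutelyContinuous (hac i j)) a b)
  intro i j
  refine ⟨absolutelyContinuous_ofReal (hac i j 0 T), ?_, (integrable_lyapunov hA hP hQ i j).neg⟩
  filter_upwards [ae_restrict_of_ae heq] with t ht
  rw [Matrix.neg_apply, complexify_lyapunov, ← Complex.ofReal_neg]
  exact (ht i j).ofReal_comp

/-- A periodic positive definite solution is determined by the equation. -/
lemma IsPeriodicLyapunovSolution.isUnique (hT : 0 < T)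
    (hA : ∀ a b, SqInt T fun t => complexify A t a b)
    (hQ : ∀ a b, SqInt T fun t => complexify Q t a b)
    (hQpos : ∀ᵐ t ∂volume.restrict (Ioc 0 T), (complexify Q t).PosDef)
    (h : IsPeriodicLyapunovSolution T A Q P) :
    IsUniqueHarmonicSolution T (toep T (complexify A)) (toep T (complexify Q))
      (toep T (complexify P)) ∧ IsUniquePeriodicSolution T A Q P := by
  have hU := isUniqueHarmonicSolution_toep hT hA hQ hQpos
    (matACDeriv_complexify hA hQ h.absCont h.equation)
    (by ext i j; simp only [complexify_apply]; rw [h.periodic.eq])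
    fun t => posDef_complexify (h.posDef t)
  refine ⟨hU, h, fun P' h' => ?_⟩
  -- Uniqueness for the differential equation is inherited from the harmonic side: equal Toeplitz
  -- matrices force equality almost everywhere, then everywhere by continuity.
  have h1 := hU.2 _ (isHarmonicLyapunovSolution_toep hT hA hQ
    (matACDeriv_complexify hA hQ h'.absCont h'.equation)
    (by ext i j; simp only [complexify_apply]; rw [h'.periodic.eq])
    fun t => posDef_complexify (h'.posDef t))
  refine eq_of_periodic_of_ae_eq hT h'.periodic h.periodic h'.continuous h.continuous
    (ae_eq_of_complexify_ae_eq (toep_injective hT (fun a b => sqInt_of_top ?_)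
      (fun a b => sqInt_of_top ?_) h1))
  · exact memLp_top_complexify_of_continuous h'.continuous a b
  · exact memLp_top_complexify_of_continuous h.continuous a b

end Periodic

/-- A function whose derivative, in the sense of Fourier coefficients, is integrable agrees almost
everywhere with a primitive. -/
lemma exists_ae_eq_add_integral {T : ℝ} (hT : 0 < T) {p g : ℝ → ℝ} (hp : SqInt T fun t => (p t : ℂ))
    (hg : Integrable (fun t => (g t : ℂ)) (volume.restrict (Ioc 0 T)))
    (h : ∀ k : ℤ, fc T (fun t => (g t : ℂ)) k =
      Complex.I * (2 * Real.pi / T : ℝ) * k * fc T (fun t => (p t : ℂ)) k) :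
    ∃ C : ℝ, p =ᵐ[volume.restrict (Ioc 0 T)] (fun t => C + ∫ s in (0 : ℝ)..t, g s) ∧
      ∫ s in (0 : ℝ)..T, g s = 0 := by
  have hT' : (T : ℂ) ≠ 0 := by exact_mod_cast hT.ne'
  -- The coefficient `k = 0` says that `g` has mean zero, so its primitive has equal boundary
  -- values.
  have h0 : ∫ s in (0 : ℝ)..T, g s = 0 := by
    have := h 0
    simpa [fc, hT', intervalIntegral.integral_ofReal] using this
  let f : ℝ → ℂ := fun t => 0 + ∫ s in (0 : ℝ)..t, (g s : ℂ)
  have hf : HasACDeriv T f fun t => (g t : ℂ) := .of_integrable hT 0 hg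
  have hf0 : f 0 = f T := by
    simp [f, h0, intervalIntegral.integral_ofReal]
  have hsub : SqInt T fun t => (p t : ℂ) - f t := hp.sub (hf.sqInt hT)
  set c := fc T (fun t => (p t : ℂ) - f t) 0
  have hc : HasACDeriv T (fun _ => c) fun _ => 0 := .const c
  -- `p` and the primitive share every coefficient with `k ≠ 0`, so they differ by the constant `c`.
  have hae := ae_eq_of_fc_eq hT hsub (hc.sqInt hT) fun k => by
    rcases eq_or_ne k 0 with rfl | hk
    · change c = _
      simp [fc, hT']
    · have hω : Complex.I * (2 * Real.pi / T : ℝ) * k ≠ 0 := by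
        have : (k : ℂ) ≠ 0 := by exact_mod_cast hk
        simp [hT', this, Real.pi_ne_zero]
      have h1 := hc.fc_deriv hT rfl k
      rw [fc_zero] at h1
      have h2 := hf.fc_deriv hT hf0 k
      rw [h k] at h2
      rw [fc_sub hT hp.integrable (hf.sqInt hT).integrable, mul_left_cancel₀ hω h2, sub_self]
      exact (mul_left_cancel₀ hω (by rw [← h1, mul_zero])).symm
  refine ⟨c.re, ?_, h0⟩
  filter_upwards [hae] with t ht
  have := congrArg Complex.re ht
  simp only [f, zero_add, intervalIntegral.integral_ofReal, Complex.sub_re, Complex.ofReal_re] at this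
  linarith

/-! ### From the harmonic equation back to the differential equation. -/

section Converse

variable {T : ℝ} {A Q P : ℝ → Matrix (Fin n) (Fin n) ℝ}

lemma sqInt_complexify_translate
    (hP : ∀ i j a b, MemLp (fun t => P t i j) 2 (volume.restrict (Icc a b))) (c : ℝ)
    (i j : Fin n) : SqInt T fun t => complexify P (t + c) i j := by
  have h1 : MemLp (fun t => P t i j) 2 (volume.restrict (Ioc (0 + c) (T + c))) :=
    (hP i j (0 + c) (T + c)).mono_measure (Measure.restrict_mono Ioc_subset_Icc_self le_rfl)
  have h2 := (measurePreserving_add_right volume c).restrict_preimage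
    (measurableSet_Ioc (a := 0 + c) (b := T + c))
  have h3 : (fun x => x + c) ⁻¹' Ioc (0 + c) (T + c) = Ioc 0 T := by
    ext x
    simp
  rw [h3] at h2
  exact (h1.comp_measurePreserving h2).ofReal

/-- If the block Toeplitz matrices of `P` do not depend on time, then `P` agrees almost everywhere
with a periodic function. -/
lemma exists_periodic_ae_eq (hT : 0 < T)
    (hP : ∀ i j a b, MemLp (fun t => P t i j) 2 (volume.restrict (Icc a b)))
    (h : ∀ s t, toeplitz T P s = toeplitz T P t) :
    ∃ P₁, Function.Periodic P₁ T ∧ P =ᵐ[volume] P₁ := by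
  refine ⟨fun t => P (toIocMod hT 0 t), fun t => by simp only [toIocMod_add_right], ?_⟩
  refine ae_eq_of_forall_translate hT fun m => ?_
  -- Windows ending at `T + m T` record the coefficients of the translate of `P` by `m T`; constancy
  -- in time identifies all translates on the period.
  have h1 : toep T (fun t => complexify P (t + m * T)) =
      toep T fun t => complexify P (t + (0 : ℤ) * T) := by
    rw [← toeplitz_eq_toep_add, ← toeplitz_eq_toep_add]
    exact h _ _
  have h2 := toep_injective hT (fun a b => sqInt_complexify_translate hP _ a b)
    (fun a b => sqInt_complexify_translate hP _ a b) h1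
  have h3 := ae_eq_of_complexify_ae_eq (F := fun t => P (t + m * T))
    (G := fun t => P (t + (0 : ℤ) * T)) h2
  filter_upwards [h3, ae_restrict_mem measurableSet_Ioc] with t ht hm
  have h4 : toIocMod hT 0 (t + m * T) = t := by
    rw [← zsmul_eq_mul, toIocMod_add_zsmul, toIocMod_eq_self, zero_add]
    exact hm
  rw [ht, h4]
  simp

/-- A periodic function solving the harmonic Lyapunov equation agrees almost everywhere with an
absolutely continuous solution of the Lyapunov differential equation. -/
lemma exists_absolutelyContinuous_solution (hT : 0 < T)
    (hA : ∀ a b, SqInt T fun t => complexify A t a b) (hAper : Function.Periodic A T)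
    (hQ : ∀ a b, SqInt T fun t => complexify Q t a b) (hQper : Function.Periodic Q T)
    (hP : ∀ a b, SqInt T fun t => complexify P t a b) (hPper : Function.Periodic P T)
    (h : infMul (toep T (complexify P)) (toep T (complexify A) - diagN n T) +
      infMul (toep T (complexify A) - diagN n T)ᴴ (toep T (complexify P)) +
      toep T (complexify Q) = 0) :
    ∃ P₀, P =ᵐ[volume] P₀ ∧ Function.Periodic P₀ T ∧
      (∀ i j a b, AbsolutelyContinuousOnInterval (fun t => P₀ t i j) a b) ∧
      ∀ᵐ t : ℝ, ∀ i j, HasDerivAt (fun s => P₀ s i j)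
        (-(((A t)ᵀ * P₀ t + P₀ t * A t + Q t) i j)) t := by
  let g : Fin n → Fin n → ℝ → ℝ := fun i j t => -(((A t)ᵀ * P t + P t * A t + Q t) i j)
  have hgper : ∀ i j, Function.Periodic (g i j) T := fun i j t => by
    simp only [g, hAper t, hQper t, hPper t]
  have hgi : ∀ i j, Integrable (fun t => (g i j t : ℂ)) (volume.restrict (Ioc 0 T)) :=
    fun i j => by
      have := (integrable_lyapunov hA hP hQ i j).neg
      simpa only [g, Complex.ofReal_neg, ← complexify_lyapunov] using! this
  have hfc : ∀ i j (k : ℤ), fc T (fun t => (g i j t : ℂ)) k =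
      Complex.I * (2 * Real.pi / T : ℝ) * k * fc T (fun t => (P t i j : ℂ)) k := fun i j k => by
    -- Column block `0` suffices: the entry depends only on the difference of block indices.
    have h1 := lyapunov_entry hT hA hP hQ (k, i) (0, j)
    rw [h] at h1
    simp only [sub_zero, Matrix.zero_apply, complexify_lyapunov] at h1
    simp only [g, Complex.ofReal_neg, fc_neg]
    simp only [complexify_apply] at h1
    linear_combination h1
  choose C hC hg0 using fun i j => exists_ae_eq_add_integral hT (hP i j) (hgi i j) (hfc i j)
  have hint : ∀ i j a b, IntervalIntegrable (g i j) volume a b := fun i j a b => by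
    refine (hgper i j).intervalIntegrable (t := 0) hT.ne' ?_ a b
    rw [zero_add, intervalIntegrable_iff_integrableOn_Ioc_of_le hT.le]
    simpa using! (hgi i j).re
  let P₀ : ℝ → Matrix (Fin n) (Fin n) ℝ := fun t => of fun i j => C i j + ∫ s in (0 : ℝ)..t, g i j s
  have hP₀per : Function.Periodic P₀ T := fun t => by
    ext i j
    have h1 := (hgper i j).intervalIntegral_add_eq t 0
    rw [zero_add, hg0] at h1
    have h2 := intervalIntegral.integral_add_adjacent_intervals (hint i j 0 t) (hint i j t (t + T))
    simp only [P₀, of_apply]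
    rw [← h2, h1, add_zero]
  have hae : P =ᵐ[volume] P₀ := by
    refine ae_eq_of_periodic hT hPper hP₀per ?_
    filter_upwards [ae_all_iff.2 fun i => ae_all_iff.2 fun j => hC i j] with t ht
    ext i j
    exact ht i j
  refine ⟨P₀, hae, hP₀per, fun i j a b => ?_, ?_⟩
  · have h1 := (hint i j a b).absolutelyContinuousOnInterval_intervalIntegral left_mem_uIcc
    have h2 := (absolutelyContinuous_const (C i j + ∫ s in (0 : ℝ)..a, g i j s) a b).fun_add h1
    have e : (fun t => P₀ t i j) =
        fun t => (C i j + ∫ s in (0 : ℝ)..a, g i j s) + ∫ s in a..t, g i j s := funext fun t => by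
      rw [add_assoc, intervalIntegral.integral_add_adjacent_intervals (hint i j 0 a) (hint i j a t)]
      rfl
    rw [e]
    exact h2
  · have h1 : ∀ i j, ∀ᵐ t : ℝ, HasDerivAt (fun s => P₀ s i j) (g i j t) t := fun i j => by
      have hl : LocallyIntegrable (g i j) volume :=
        locallyIntegrable_iff.2 fun K hK => by
          obtain ⟨a, b, hab⟩ := bddBelow_bddAbove_iff_subset_Icc.1 ⟨hK.bddBelow, hK.bddAbove⟩
          refine IntegrableOn.mono_set ?_ (hab.trans (Icc_subset_uIcc))
          exact (intervalIntegrable_iff' (by simp)).1 (hint i j a b)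
      filter_upwards [LocallyIntegrable.ae_hasDerivAt_integral hl] with t ht
      exact (ht 0).const_add _
    filter_upwards [ae_all_iff.2 fun i => ae_all_iff.2 fun j => h1 i j, hae] with t ht he i j
    simpa only [g, he] using! ht i j

/-- Positivity of the block Toeplitz matrix passes to a continuous periodic symbol. -/
lemma re_quadratic_nonneg_of_isPositiveDefinite (hT : 0 < T) (hPper : Function.Periodic P T)
    (hPc : ∀ i j, Continuous fun t => P t i j)
    (h : IsPositiveDefinite (toep T (complexify P))) (v : Fin n → ℂ) (t : ℝ) :
    0 ≤ (star v ⬝ᵥ (complexify P t *ᵥ v)).re := by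
  let φ : ℝ → ℝ := fun t => (star v ⬝ᵥ (complexify P t *ᵥ v)).re
  have hφc : Continuous φ := by
    refine Complex.continuous_re.comp (Continuous.dotProduct continuous_const
      (Continuous.matrix_mulVec (continuous_matrix fun i j => ?_) continuous_const))
    exact Complex.continuous_ofReal.comp (hPc i j)
  have hφper : Function.Periodic φ T := fun t => by simp only [φ, complexify, hPper t]
  have htop := fun i j => memLp_top_complexify_of_continuous (T := T) hPc i j
  have hnn : 0 ≤ᵐ[volume.restrict (Ioc 0 T)] φ := by
    refine ae_nonneg_of_forall_setIntegral_nonneg (hφc.integrableOn_Ioc) fun s hs _ => ?_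
    let x : ℝ → Fin n → ℂ := fun t => s.indicator (fun _ => v) t
    have hx : ∀ a, SqInt T fun t => x t a := fun a => by
      have e : (fun t => x t a) = s.indicator fun _ => v a := by
        ext t
        by_cases ht : t ∈ s <;> simp [x, ht]
      rw [e]
      -- Testing on `v` times the indicator of an arbitrary measurable `s` gives `∫_s φ ≥ 0`.
      exact (memLp_const (v a)).indicator hs
    obtain ⟨X, hX⟩ := exists_sequence_represents hT hx
    obtain ⟨Y, hXY, hY⟩ := exists_actsTo_toep hT htop hX
    have h1 : 0 ≤ (inner ℂ X Y).re := by
      rcases eq_or_ne X 0 with rfl | hne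
      · simp
      · exact (h X Y hXY hne).le
    rw [hX.re_inner_eq hT hY] at h1
    have e : ∀ t, (star (x t) ⬝ᵥ (complexify P t *ᵥ x t)).re = s.indicator φ t := fun t => by
      by_cases ht : t ∈ s <;> simp [x, ht, φ]
    simp only [e] at h1
    rw [integral_indicator hs] at h1
    exact nonneg_of_mul_nonneg_right h1 (by positivity)
  have h2 : φ =ᵐ[volume] fun t => max (φ t) 0 := by
    refine ae_eq_of_periodic hT hφper (fun t => by simp only [hφper t]) ?_
    filter_upwards [hnn] with t ht
    exact (max_eq_left ht).symm
  have h3 := (Continuous.ae_eq_iff_eq volume hφc (hφc.max continuous_const)).1 h2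
  have h4 := congrFun h3 t
  exact max_eq_left_iff.1 h4.symm

/-- An absolutely continuous periodic solution with positive block Toeplitz matrix is positive
definite. -/
lemma isPeriodicLyapunovSolution_of_isPositiveDefinite (hT : 0 < T)
    (hA : ∀ a b, SqInt T fun t => complexify A t a b)
    (hQ : ∀ a b, SqInt T fun t => complexify Q t a b)
    (hQpos : ∀ᵐ t ∂volume.restrict (Ioc 0 T), (complexify Q t).PosDef)
    (hPper : Function.Periodic P T)
    (hac : ∀ i j a b, AbsolutelyContinuousOnInterval (fun t => P t i j) a b)
    (heq : ∀ᵐ t : ℝ, ∀ i j, HasDerivAt (fun s => P s i j)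
      (-(((A t)ᵀ * P t + P t * A t + Q t) i j)) t)
    (hherm : (toep T (complexify P)).IsHermitian)
    (hpos : IsPositiveDefinite (toep T (complexify P))) :
    IsPeriodicLyapunovSolution T A Q P := by
  have hc : ∀ i j, Continuous fun t => P t i j := fun i j =>
    continuous_of_absolutelyContinuous (hac i j)
  have hsq : ∀ a b, SqInt T fun t => complexify P t a b := fun a b =>
    sqInt_of_top (memLp_top_complexify_of_continuous hc a b)
  have hsymm : (fun t => (P t)ᵀ) = P := by
    refine eq_of_periodic_of_ae_eq hT (fun t => by simp only [hPper t]) hPper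
      (fun i j => hc j i) hc (ae_eq_of_complexify_ae_eq (toep_injective hT (fun a b => hsq b a) hsq ?_))
    have h1 := hherm
    rw [Matrix.IsHermitian, conjTranspose_toep hT] at h1
    simpa only [conjTranspose_complexify] using h1
  have hnn := re_quadratic_nonneg_of_isPositiveDefinite hT hPper hc hpos
  have hode := matACDeriv_complexify (T := T) hA hQ hac heq
  obtain ⟨Φ, Ψ, hΦ, -, hΨ⟩ := exists_fundamental_matrix hT fun i j => (hA i j).integrable
  refine ⟨hPper, fun t => .of_dotProduct_mulVec_pos (congrFun hsymm t) fun w hw => ?_, hac, heq⟩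
  -- The right end is excluded because strict decay from `s` to `T` requires `s < T`.
  obtain ⟨s, hs, hts⟩ : ∃ s ∈ Ico 0 T, P t = P s :=
    ⟨toIcoMod hT 0 t, by simpa using toIcoMod_mem_Ico hT 0 t, by
      rw [toIcoMod, hPper.sub_zsmul_eq]⟩
  let v : Fin n → ℂ := fun i => (w i : ℂ)
  have hΦΨ : Φ s * Ψ s = 1 := mul_eq_one_comm.1 (hΨ s (Ico_subset_Icc_self hs))
  have hv : Φ s *ᵥ (Ψ s *ᵥ v) = v := by rw [mulVec_mulVec, hΦΨ, one_mulVec]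
  have hne : Ψ s *ᵥ v ≠ 0 := fun h0 => hw (by
    rw [h0, mulVec_zero] at hv
    ext i
    exact Complex.ofReal_injective (congrFun hv i).symm)
  -- The trajectory through `v` at time `s` starts from `Ψ s *ᵥ v`; its form is nonnegative at `T`,
  -- hence positive at `s`.
  have h1 := re_quadratic_flow_lt hT hode hΦ hΨ hQpos hs.1 hs.2 le_rfl hne
  rw [hv] at h1
  have h2 := (hnn _ T).trans_lt h1
  rw [hts]
  have h3 := re_quadratic_ofReal (P s) w
  rw [star_trivial, ← h3]
  exact h2

/-- A time-dependent block Toeplitz matrix which at every time is the unique solution of the harmonic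
Lyapunov equation comes from a periodic solution of the Lyapunov differential equation. -/
lemma exists_isPeriodicLyapunovSolution (hT : 0 < T)
    (hA : ∀ a b, SqInt T fun t => complexify A t a b) (hAper : Function.Periodic A T)
    (hQ : ∀ a b, SqInt T fun t => complexify Q t a b) (hQper : Function.Periodic Q T)
    (hQpos : ∀ᵐ t ∂volume.restrict (Ioc 0 T), (complexify Q t).PosDef)
    (hP : ∀ i j a b, MemLp (fun t => P t i j) 2 (volume.restrict (Icc a b)))
    (h : ∀ t, IsUniqueHarmonicSolution T (toeplitz T A t) (toeplitz T Q t) (toeplitz T P t)) :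
    ∃ P₀, P =ᵐ[volume] P₀ ∧ IsPeriodicLyapunovSolution T A Q P₀ := by
  simp only [toeplitz_eq_toep hAper, toeplitz_eq_toep hQper] at h
  -- By periodicity of `A` and `Q` the equations at times `s` and `t` coincide, so uniqueness at `t`
  -- applies to the solution at `s`.
  obtain ⟨P₁, hP₁per, hPP₁⟩ := exists_periodic_ae_eq hT hP fun s t => (h t).2 _ (h s).1
  have hP₁ : ∀ a b, SqInt T fun t => complexify P₁ t a b := fun a b => by
    have h1 : SqInt T fun t => complexify P (t + 0) a b := sqInt_complexify_translate hP 0 a b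
    refine (memLp_congr_ae (ae_restrict_of_ae ?_)).1 h1
    filter_upwards [hPP₁] with t ht
    rw [add_zero, complexify, complexify, ht]
  have h1 : ∀ P₂, Function.Periodic P₂ T → P =ᵐ[volume] P₂ →
      IsUniqueHarmonicSolution T (toep T (complexify A)) (toep T (complexify Q))
        (toep T (complexify P₂)) := fun P₂ hper hae => by
    rw [← toeplitz_eq_toep hper 0, ← toeplitz_congr_ae hae]
    exact h 0
  obtain ⟨P₀, hP₁P₀, hper, hac, heq⟩ := exists_absolutelyContinuous_solution hT hA hAper hQ hQper hP₁
    hP₁per (h1 P₁ hP₁per hPP₁).1.equation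
  have h2 := h1 P₀ hper (hPP₁.trans hP₁P₀)
  exact ⟨P₀, hPP₁.trans hP₁P₀, isPeriodicLyapunovSolution_of_isPositiveDefinite hT hA hQ hQpos hper hac
    heq h2.1.hermitian h2.1.posDef⟩

end Converse

end Harmonic

/-! ### The main theorem. -/

theorem mainTheorem7 {n : ℕ} (T : ℝ) (hT : 0 < T)
    (A Q : ℝ → Matrix (Fin n) (Fin n) ℝ)
    (hA : ∀ i j, MemLp (fun t => A t i j) 2 (volume.restrict (Set.Icc 0 T)))
    (hAper : Function.Periodic A T)
    (hQ : ∀ i j, MemLp (fun t => Q t i j) ⊤ (volume.restrict (Set.Icc 0 T)))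
    (hQper : Function.Periodic Q T)
    (hQpos : ∀ᵐ t : ℝ, (Q t).PosDef) :
    (∀ t, (Harmonic.toeplitz T Q t).IsHermitian ∧
      Harmonic.IsBoundedOnEllTwo (Harmonic.toeplitz T Q t) ∧
      Harmonic.IsPositiveDefinite (Harmonic.toeplitz T Q t)) ∧
    ∀ P : ℝ → Matrix (Fin n) (Fin n) ℝ,
      (∀ i j a b, MemLp (fun t => P t i j) 2 (volume.restrict (Set.Icc a b))) →
      ((∃ P₀, P =ᵐ[volume] P₀ ∧ Harmonic.IsUniquePeriodicSolution T A Q P₀) ↔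
        ∀ t, Harmonic.IsUniqueHarmonicSolution T (Harmonic.toeplitz T A t)
          (Harmonic.toeplitz T Q t) (Harmonic.toeplitz T P t)) ∧
      ((∀ t, Harmonic.IsUniqueHarmonicSolution T (Harmonic.toeplitz T A t)
          (Harmonic.toeplitz T Q t) (Harmonic.toeplitz T P t)) →
        ∀ t, Harmonic.IsBoundedOnEllTwo (Harmonic.toeplitz T P t)) := by
  have hle : volume.restrict (Set.Ioc 0 T) ≤ volume.restrict (Set.Icc 0 T) :=
    Measure.restrict_mono Set.Ioc_subset_Icc_self le_rfl
  have hA' : ∀ i j, Harmonic.SqInt T fun t => Harmonic.complexify A t i j :=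
    fun i j => ((hA i j).mono_measure hle).ofReal
  have hQtop : ∀ i j, MemLp (fun t => Harmonic.complexify Q t i j) ⊤
    (volume.restrict (Set.Ioc 0 T)) := fun i j => ((hQ i j).mono_measure hle).ofReal
  have hQ' : ∀ i j, Harmonic.SqInt T fun t => Harmonic.complexify Q t i j :=
    fun i j => Harmonic.sqInt_of_top (hQtop i j)
  have hQpos' := Harmonic.ae_posDef_complexify hQpos (Set.Ioc 0 T)
  refine ⟨fun t => ?_, fun P hP => ⟨⟨?_, fun h => ?_⟩, fun h t => ?_⟩⟩
  · rw [Harmonic.toeplitz_eq_toep hQper]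
    refine ⟨?_, Harmonic.isBoundedOnEllTwo_toep hT hQtop,
      Harmonic.isPositiveDefinite_toep hT hQtop hQpos'⟩
    rw [Matrix.IsHermitian, Harmonic.conjTranspose_toep hT]
    refine Harmonic.toep_congr_ae hT ?_
    filter_upwards [hQpos'] with t ht using ht.1
  · rintro ⟨P₀, hae, h₀, -⟩ t
    rw [Harmonic.toeplitz_congr_ae hae, Harmonic.toeplitz_eq_toep hAper,
      Harmonic.toeplitz_eq_toep hQper, Harmonic.toeplitz_eq_toep h₀.periodic]
    exact (h₀.isUnique hT hA' hQ' hQpos').1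
  · obtain ⟨P₀, hae, h₀⟩ :=
      Harmonic.exists_isPeriodicLyapunovSolution hT hA' hAper hQ' hQper hQpos' hP h
    exact ⟨P₀, hae, (h₀.isUnique hT hA' hQ' hQpos').2⟩
  · obtain ⟨P₀, hae, h₀⟩ :=
      Harmonic.exists_isPeriodicLyapunovSolution hT hA' hAper hQ' hQper hQpos' hP h
    -- The Toeplitz matrix ignores null sets, so the continuous representative, bounded on a period,
    -- can serve as symbol.
    rw [Harmonic.toeplitz_congr_ae hae, Harmonic.toeplitz_eq_toep h₀.periodic]
    exact Harmonic.isBoundedOnEllTwo_toep hT fun i j =>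
      Harmonic.memLp_top_complexify_of_continuous h₀.continuous i j
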